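/- **Setting.** Let $\mathcal S_1,\mathcal S_2,\mathcal W,\mathcal W_3,\mathcal X_1,\mathcal X_2,\mathcal X_3,\mathcal Y,\mathcal Y_3$ be finite alphabets. The sources and side information $(S_{1,k},S_{2,k},W_k,W_{3,k})$, $k\ge 1$, are i.i.d. with an arbitrary joint p.m.f. $p(s_1,s_2,w,w_3)$. A discrete memoryless multiple-access relay channel (DM MARC) is given by a transition law $p(y,y_3|x_1,x_2,x_3)$: at each time the pair of the receiver output $Y$ and the relay output $Y_3$ depends on the past channel inputs and outputs and on the sources and side information only through the current inputs, and has this law given them. An $(m,n)$ source-channel code consists of encoders $f_i:\mathcal S_i^m\to\mathcal X_i^n$ ($i=1,2$), causal relay functions $x_{3,k}=f_{3,k}(y_{3,1},\dots,y_{3,k-1},w_3^m)$ ($1\le k\le n$), and a decoder $g:\mathcal Y^n\times\mathcal W^m\to\mathcal S_1^m\times\mathcal S_2^m$ with $(\hat S_1^m,\hat S_2^m)=g(Y^n,W^m)$; its error probability is $P_e^{(m,n)}=\Pr\{(\hat S_1^m,\hat S_2^m)\ne(S_1^m,S_2^m)\}$. A real number $\kappa$ (channel uses per source sample) is an achievable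 source-channel rate if for every $\epsilon>0$ and all $n_0,m_0\in\mathbb N$ there are $n>n_0$ and $m>m_0$ with $n\le\kappa m$ and an $(m,n)$ code with $P_e^{(m,n)}<\epsilon$. **Theorem.** Let $\kappa$ be achievable for such sources and such a DM MARC. Then: (a) there is a p.m.f. $p(x_1,x_2,x_3)$ such that, for $(X_1,X_2,X_3,Y,Y_3)\sim p(x_1,x_2,x_3)\,p(y,y_3|x_1,x_2,x_3)$, $$H(S_1|S_2,W)\le\kappa I(X_1,X_3;Y|X_2),\quad H(S_2|S_1,W)\le\kappa I(X_2,X_3;Y|X_1),\quad H(S_1,S_2|W)\le\kappa I(X_1,X_2,X_3;Y);$$ (b) there are a finite set $\mathcal V$ with $|\mathcal V|\le4$ and a p.m.f. of the form $p(v)\,p(x_1,x_2|v)\,p(x_3|v)$ on $\mathcal V\times\mathcal X_1\times\mathcal X_2\times\mathcal X_3$ such that, for $(V,X_1,X_2,X_3,Y,Y_3)\sim p(v)\,p(x_1,x_2|v)\,p(x_3|v)\,p(y,y_3|x_1,x_2,x_3)$, $$H(S_1|S_2,W,W_3)\le\kappa I(X_1;Y,Y_3|X_2,V),\quad H(S_2|S_1,W,W_3)\le\kappa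 I(X_2;Y,Y_3|X_1,V),\quad H(S_1,S_2|W,W_3)\le\kappa I(X_1,X_2;Y,Y_3|V).$$ -/

import Mathlib

/-!
Multiple-access relay channel (MARC) with correlated sources and side information:
entropies on finite alphabets, source-channel codes, error probability, achievable rates.

A p.m.f. on a finite alphabet is a point of Mathlib's `stdSimplex ℝ α`.
All logarithms are natural; every claim is homogeneous in the base of the logarithm.
-/

namespace MARC

noncomputable section

open scoped Classical in
/-- The p.m.f. of the random variable `X : Ω → α`, where the finite space `Ω` carries the
p.m.f. `p`: `law p X a = Pr {X = a}`. -/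
def law {Ω α : Type*} [Fintype Ω] (p : Ω → ℝ) (X : Ω → α) (a : α) : ℝ :=
  ∑ ω, if X ω = a then p ω else 0

/-- Entropy `H(X) = - ∑ p(x) log p(x)`. -/
def entropy {Ω α : Type*} [Fintype Ω] [Fintype α] (p : Ω → ℝ) (X : Ω → α) : ℝ :=
  -∑ a, law p X a * Real.log (law p X a)

/-- Conditional entropy `H(X | Z) = - ∑ p(x,z) log p(x|z)`, where `p(x|z) = p(x,z) / p(z)`
(terms with `p(x,z) = 0` vanish). -/
def condEntropy {Ω α γ : Type*} [Fintype Ω] [Fintype α] [Fintype γ]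
    (p : Ω → ℝ) (X : Ω → α) (Z : Ω → γ) : ℝ :=
  -∑ a, ∑ c, law p (fun ω => (X ω, Z ω)) (a, c) *
    Real.log (law p (fun ω => (X ω, Z ω)) (a, c) / law p Z c)

/-- Mutual information `I(X ; Y) = H(X) - H(X | Y)`. -/
def mutualInfo {Ω α β : Type*} [Fintype Ω] [Fintype α] [Fintype β]
    (p : Ω → ℝ) (X : Ω → α) (Y : Ω → β) : ℝ :=
  entropy p X - condEntropy p X Y

/-- Conditional mutual information `I(X ; Y | Z) = H(X | Z) - H(X | Y, Z)`. -/
def condMutualInfo {Ω α β γ : Type*} [Fintype Ω] [Fintype α] [Fintype β] [Fintype γ]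
    (p : Ω → ℝ) (X : Ω → α) (Y : Ω → β) (Z : Ω → γ) : ℝ :=
  condEntropy p X Z - condEntropy p X (fun ω => (Y ω, Z ω))

/-- The discrete memoryless MARC: to every input triple `(x₁, x₂, x₃)` it assigns the p.m.f.
`p(y, y₃ | x₁, x₂, x₃)` of the pair of outputs at the receiver and at the relay. -/
abbrev Channel (X₁ X₂ X₃ Y Y₃ : Type*) [Fintype Y] [Fintype Y₃] :
    Type _ :=
  X₁ → X₂ → X₃ → stdSimplex ℝ (Y × Y₃)

/-- A joint p.m.f. `p(s₁, s₂, w, w₃)` of the sources, the receiver side information `w` and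
the relay side information `w₃`. -/
abbrev Source (S₁ S₂ W W₃ : Type*) [Fintype S₁] [Fintype S₂] [Fintype W] [Fintype W₃] :
    Type _ :=
  stdSimplex ℝ (S₁ × S₂ × W × W₃)

/-- An `(m, n)` source-channel code for the MARC: `m` source samples, `n` channel uses.
The relay input at time `k` depends on the relay outputs at times before `k` and on the whole
relay side information sequence. -/
structure Code (S₁ S₂ W W₃ X₁ X₂ X₃ Y Y₃ : Type*) (m n : ℕ) where
  enc₁ : (Fin m → S₁) → Fin n → X₁
  enc₂ : (Fin m → S₂) → Fin n → X₂
  relay : (k : Fin n) → (Fin (k : ℕ) → Y₃) → (Fin m → W₃) → X₃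
  dec : (Fin n → Y) → (Fin m → W) → (Fin m → S₁) × (Fin m → S₂)

section Code

variable {S₁ S₂ W W₃ X₁ X₂ X₃ Y Y₃ : Type*}
  [Fintype S₁] [Fintype S₂] [Fintype W] [Fintype W₃] [Fintype Y] [Fintype Y₃] {m n : ℕ}

/-- The joint probability, under the code `C`, of the source and side information sequence `s`
and the channel output sequence `y`: the source samples are i.i.d. with p.m.f. `Q`, and, the
channel being memoryless and used without feedback to the transmitters, the `k`-th output pair
has p.m.f. `p(· | x₁ₖ, x₂ₖ, x₃ₖ)` given everything before it. -/
def Code.jointProb (C : Code S₁ S₂ W W₃ X₁ X₂ X₃ Y Y₃ m n)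
    (Q : Source S₁ S₂ W W₃) (ch : Channel X₁ X₂ X₃ Y Y₃)
    (s : Fin m → S₁ × S₂ × W × W₃) (y : Fin n → Y × Y₃) : ℝ :=
  (∏ i, Q (s i)) *
    ∏ k : Fin n, ch (C.enc₁ (fun i => (s i).1) k) (C.enc₂ (fun i => (s i).2.1) k)
      (C.relay k (fun j => (y (Fin.castLE k.isLt.le j)).2) (fun i => (s i).2.2.2)) (y k)

open scoped Classical in
/-- The average probability of error `Pr {(Ŝ₁ᵐ, Ŝ₂ᵐ) ≠ (S₁ᵐ, S₂ᵐ)}`. -/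
def Code.errorProb (C : Code S₁ S₂ W W₃ X₁ X₂ X₃ Y Y₃ m n)
    (Q : Source S₁ S₂ W W₃) (ch : Channel X₁ X₂ X₃ Y Y₃) : ℝ :=
  ∑ s : Fin m → S₁ × S₂ × W × W₃, ∑ y : Fin n → Y × Y₃,
    if C.dec (fun k => (y k).1) (fun i => (s i).2.2.1) ≠
        (fun i => (s i).1, fun i => (s i).2.1)
    then C.jointProb Q ch s y else 0

/-- The source-channel rate `κ` (channel uses per source sample) is achievable: there are codes
with arbitrarily large `m` and `n`, with `n ≤ κ m`, and with arbitrarily small probability of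
error. -/
def Achievable (Q : Source S₁ S₂ W W₃) (ch : Channel X₁ X₂ X₃ Y Y₃) (κ : ℝ) : Prop :=
  ∀ ε : ℝ, 0 < ε → ∀ n₀ m₀ : ℕ, ∃ n m : ℕ, n₀ < n ∧ m₀ < m ∧ (n : ℝ) ≤ κ * m ∧
    ∃ C : Code S₁ S₂ W W₃ X₁ X₂ X₃ Y Y₃ m n, C.errorProb Q ch < ε

/-- `Achievable` follows from the version that asks for a code at all large `n`, `m` with
`n ≤ κ m`. -/
theorem Achievable.of_forall_large {Q : Source S₁ S₂ W W₃} {ch : Channel X₁ X₂ X₃ Y Y₃}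
    {κ : ℝ} (hκ : 0 < κ)
    (h : ∀ ε : ℝ, 0 < ε → ∃ n₀ m₀ : ℕ, ∀ n m : ℕ, n₀ < n → m₀ < m → (n : ℝ) ≤ κ * m →
      ∃ C : Code S₁ S₂ W W₃ X₁ X₂ X₃ Y Y₃ m n, C.errorProb Q ch < ε) :
    Achievable Q ch κ := by
  intro ε hε n₀ m₀
  obtain ⟨n₁, m₁, h₁⟩ := h ε hε
  obtain ⟨M, hM⟩ := exists_nat_gt (((n₀ + n₁ + 1 : ℕ) : ℝ) / κ)
  have hn : ((n₀ + n₁ + 1 : ℕ) : ℝ) ≤ κ * ((m₀ + m₁ + 1 + M : ℕ) : ℝ) := by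
    rw [div_lt_iff₀ hκ] at hM
    have h0 : (0 : ℝ) ≤ κ * ((m₀ + m₁ + 1 : ℕ) : ℝ) := by positivity
    push_cast at hM h0 ⊢
    nlinarith
  exact ⟨n₀ + n₁ + 1, m₀ + m₁ + 1 + M, by omega, by omega, hn,
    h₁ _ _ (by omega) (by omega) hn⟩

/-- `Achievable` follows from the existence of a sequence of codes of fixed ratio `κ = n / m`
whose probability of error tends to `0` as `m, n → ∞`. -/
theorem Achievable.of_seq {Q : Source S₁ S₂ W W₃} {ch : Channel X₁ X₂ X₃ Y Y₃} {κ : ℝ}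
    (m n : ℕ → ℕ) (hm : Filter.Tendsto m Filter.atTop Filter.atTop)
    (hn : Filter.Tendsto n Filter.atTop Filter.atTop) (hκ : ∀ t, (n t : ℝ) = κ * m t)
    (C : ∀ t, Code S₁ S₂ W W₃ X₁ X₂ X₃ Y Y₃ (m t) (n t))
    (hC : Filter.Tendsto (fun t => (C t).errorProb Q ch) Filter.atTop (nhds 0)) :
    Achievable Q ch κ := by
  intro ε hε n₀ m₀
  obtain ⟨t, h₁, h₂, h₃⟩ := ((hC.eventually_lt_const hε).and
    ((hn.eventually_gt_atTop n₀).and (hm.eventually_gt_atTop m₀))).exists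
  exact ⟨n t, m t, h₂, h₃, (hκ t).le, C t, h₁⟩

end Code

section SingleLetter

variable {X₁ X₂ X₃ Y Y₃ V : Type*} [Fintype X₁] [Fintype X₂] [Fintype X₃] [Fintype Y]
  [Fintype Y₃] [Fintype V]

/-- The joint p.m.f. `p(x₁, x₂, x₃) p(y, y₃ | x₁, x₂, x₃)`. -/
def inputOutputLaw (ch : Channel X₁ X₂ X₃ Y Y₃) (p : stdSimplex ℝ (X₁ × X₂ × X₃)) :
    X₁ × X₂ × X₃ × Y × Y₃ → ℝ :=
  fun ω => p (ω.1, ω.2.1, ω.2.2.1) * ch ω.1 ω.2.1 ω.2.2.1 ω.2.2.2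

/-- The joint p.m.f. `p(v) p(x₁, x₂ | v) p(x₃ | v) p(y, y₃ | x₁, x₂, x₃)`. -/
def auxInputOutputLaw (ch : Channel X₁ X₂ X₃ Y Y₃) (pV : stdSimplex ℝ V)
    (p₁₂ : V → stdSimplex ℝ (X₁ × X₂)) (p₃ : V → stdSimplex ℝ X₃) :
    V × X₁ × X₂ × X₃ × Y × Y₃ → ℝ :=
  fun ω => pV ω.1 * p₁₂ ω.1 (ω.2.1, ω.2.2.1) * p₃ ω.1 ω.2.2.2.1 *
    ch ω.2.1 ω.2.2.1 ω.2.2.2.1 ω.2.2.2.2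

end SingleLetter

end

end MARC

/-! All six bounds are instances of one inequality, `converse_bound`, and each instance is a single
use of Gibbs' inequality on the whole block instead of a chain of entropy identities. Let a decoder
recover the part `A` of the sources from channel observations `O` and side information `B`. Compare
the true law `P` of source and output sequences with a test measure `T`: the letters of `B` are
drawn i.i.d.; each observation is drawn from its single-letter conditional law `q` given `U` and a
label; `A` is drawn around the decoder's guess (`fanoWeight`); the remaining details of sources and
outputs are drawn from their true conditional laws. This makes sense because `U` and the label are
functions of past observations and of `B` alone, and it gives `T` total mass at most one. Gibbs'
inequality `E_P log (T / P) ≤ 0` then reads `m H(A|B) ≤ n I(R; O | U, label) + log 2 + P_e m log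
|α|`, with the information computed for the time-averaged law of label and input. Since `q` is taken
from that averaged law, no separate concavity argument is needed. For (a), `O` is the receiver
output and the label is trivial. For (b), `O` is the output pair and `B` contains the relay side
information, so the label may be the time together with all that the relay knows. The relay input is
a function of this label, which makes `X₃` deterministic given `V`. The error terms vanish only in a
limit, while the label alphabet grows with the block. In (b) the limit is therefore taken among
triples of informations, in the compact convex hull of a compact subset of `ℝ³`; Carathéodory's
theorem then writes the limit with four points, which become the values of `V`. -/

namespace MARC

open Finset Filter

/-! ### Entropy and information calculus on finite spaces. -/

section Law

variable {Ω α β γ : Type*} [Fintype Ω] {p : Ω → ℝ}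

theorem law_nonneg (hp : ∀ ω, 0 ≤ p ω) (X : Ω → α) (a : α) : 0 ≤ law p X a :=
  Finset.sum_nonneg fun ω _ => by split_ifs <;> simp [hp]

theorem le_law (hp : ∀ ω, 0 ≤ p ω) (X : Ω → α) (ω : Ω) : p ω ≤ law p X (X ω) := by
  classical
  have h := Finset.single_le_sum (f := fun ω' => if X ω' = X ω then p ω' else 0)
    (fun ω' _ => by split_ifs <;> simp [hp]) (Finset.mem_univ ω)
  simp only [if_true] at h
  unfold law
  convert h

theorem law_pos (hp : ∀ ω, 0 ≤ p ω) (X : Ω → α) {ω : Ω} (h : 0 < p ω) : 0 < law p X (X ω) :=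
  h.trans_le (le_law hp X ω)

theorem law_congr {X : Ω → α} {X' : Ω → β} {a : α} {b : β}
    (h : ∀ ω, X ω = a ↔ X' ω = b) : law p X a = law p X' b := by
  classical
  unfold law
  exact Finset.sum_congr rfl fun ω _ => if_congr (h ω) rfl rfl

theorem sum_law_mul [Fintype α] (X : Ω → α) (f : α → ℝ) :
    ∑ a, law p X a * f a = ∑ ω, p ω * f (X ω) := by
  classical
  simp only [law, Finset.sum_mul]
  rw [Finset.sum_comm]
  refine Finset.sum_congr rfl fun ω _ => ?_
  simp [ite_mul]

theorem sum_law [Fintype α] (X : Ω → α) : ∑ a, law p X a = ∑ ω, p ω := by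
  simpa using sum_law_mul (p := p) X fun _ => 1

theorem sum_law_prod [Fintype α] (X : Ω → α) (Z : Ω → γ) (c : γ) :
    ∑ a, law p (fun ω => (X ω, Z ω)) (a, c) = law p Z c := by
  classical
  simp only [law, Prod.mk.injEq]
  rw [Finset.sum_comm]
  refine Finset.sum_congr rfl fun ω _ => ?_
  by_cases h : Z ω = c <;> simp [h]

theorem law_comp_equiv {Ω' : Type*} [Fintype Ω'] (e : Ω' ≃ Ω) (X : Ω → α) (a : α) :
    law (fun ω => p (e ω)) (fun ω => X (e ω)) a = law p X a := by
  classical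
  exact e.sum_comp fun ω => if X ω = a then p ω else 0

theorem entropy_eq [Fintype α] (X : Ω → α) :
    entropy p X = -∑ ω, p ω * Real.log (law p X (X ω)) := by
  rw [entropy, sum_law_mul X fun a => Real.log (law p X a)]

theorem condEntropy_eq [Fintype α] [Fintype γ] (X : Ω → α) (Z : Ω → γ) :
    condEntropy p X Z =
      -∑ ω, p ω * Real.log (law p (fun ω => (X ω, Z ω)) (X ω, Z ω) / law p Z (Z ω)) := by
  rw [condEntropy, ← Fintype.sum_prod_type'
    (f := fun a c => law p (fun ω => (X ω, Z ω)) (a, c) *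
      Real.log (law p (fun ω => (X ω, Z ω)) (a, c) / law p Z c)),
    sum_law_mul (fun ω => (X ω, Z ω))
      fun d => Real.log (law p (fun ω => (X ω, Z ω)) (d.1, d.2) / law p Z d.2)]

theorem condEntropy_eq_sub [Fintype α] [Fintype γ] (hp : ∀ ω, 0 ≤ p ω) (X : Ω → α) (Z : Ω → γ) :
    condEntropy p X Z = entropy p (fun ω => (X ω, Z ω)) - entropy p Z := by
  rw [condEntropy_eq, entropy_eq, entropy_eq, neg_sub_neg, ← neg_sub, neg_inj,
    ← Finset.sum_sub_distrib]
  refine Finset.sum_congr rfl fun ω _ => ?_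
  rcases (hp ω).eq_or_lt with h | h
  · simp [← h]
  · rw [Real.log_div (law_pos hp (fun ω => (X ω, Z ω)) h).ne' (law_pos hp Z h).ne', mul_sub]

theorem condMutualInfo_eq [Fintype α] [Fintype β] [Fintype γ]
    (X : Ω → α) (Y : Ω → β) (Z : Ω → γ) :
    condMutualInfo p X Y Z =
      ∑ ω, p ω * (Real.log (law p (fun ω => (X ω, Y ω, Z ω)) (X ω, Y ω, Z ω) /
          law p (fun ω => (Y ω, Z ω)) (Y ω, Z ω)) -
        Real.log (law p (fun ω => (X ω, Z ω)) (X ω, Z ω) / law p Z (Z ω))) := by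
  rw [condMutualInfo, condEntropy_eq, condEntropy_eq, neg_sub_neg, ← Finset.sum_sub_distrib]
  simp only [mul_sub]

theorem condMutualInfo_congr_right {γ' : Type*} [Fintype α] [Fintype β] [Fintype γ] [Fintype γ']
    (X : Ω → α) (Y : Ω → β) {Z : Ω → γ} {Z' : Ω → γ'}
    (h : ∀ ω ω', Z ω = Z ω' ↔ Z' ω = Z' ω') :
    condMutualInfo p X Y Z = condMutualInfo p X Y Z' := by
  rw [condMutualInfo_eq, condMutualInfo_eq]
  refine Finset.sum_congr rfl fun ω _ => ?_
  congr 4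
  all_goals exact law_congr fun ω' => by simp [h]

theorem condMutualInfo_comp_equiv {Ω' : Type*} [Fintype Ω'] [Fintype α] [Fintype β] [Fintype γ]
    (e : Ω' ≃ Ω) (X : Ω → α) (Y : Ω → β) (Z : Ω → γ) :
    condMutualInfo (fun ω => p (e ω)) (fun ω => X (e ω)) (fun ω => Y (e ω)) (fun ω => Z (e ω)) =
      condMutualInfo p X Y Z := by
  rw [condMutualInfo_eq, condMutualInfo_eq, ← e.sum_comp]
  refine Finset.sum_congr rfl fun ω _ => ?_
  rw [law_comp_equiv e (fun ω => (X ω, Y ω, Z ω)), law_comp_equiv e (fun ω => (Y ω, Z ω)),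
    law_comp_equiv e (fun ω => (X ω, Z ω)), law_comp_equiv e Z]

theorem mutualInfo_eq_condMutualInfo [Fintype α] [Fintype β] (hp : ∑ ω, p ω = 1)
    (X : Ω → α) (Y : Ω → β) :
    mutualInfo p X Y = condMutualInfo p X Y (fun _ => ()) := by
  have h1 : law p (fun _ : Ω => ()) () = 1 := by simp [law, hp]
  rw [mutualInfo, condMutualInfo, entropy_eq, condEntropy_eq, condEntropy_eq, condEntropy_eq]
  congr 2
  · refine Finset.sum_congr rfl fun ω _ => ?_
    rw [h1, div_one]
    congr 2
    exact law_congr fun ω' => by simp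
  · refine Finset.sum_congr rfl fun ω _ => ?_
    congr 3 <;> exact law_congr fun ω' => by simp

/-- Gibbs' inequality for a sub-probability `T`. -/
theorem sum_mul_log_div_nonpos {T : Ω → ℝ} (hp : ∀ ω, 0 ≤ p ω) (hT : ∀ ω, 0 ≤ T ω)
    (hpos : ∀ ω, 0 < p ω → 0 < T ω) (hsum : ∑ ω, T ω ≤ ∑ ω, p ω) :
    ∑ ω, p ω * Real.log (T ω / p ω) ≤ 0 := by
  calc ∑ ω, p ω * Real.log (T ω / p ω) ≤ ∑ ω, (T ω - p ω) := by
        refine Finset.sum_le_sum fun ω _ => ?_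
        rcases (hp ω).eq_or_lt with h | h
        · simp [← h, hT]
        · calc p ω * Real.log (T ω / p ω) ≤ p ω * (T ω / p ω - 1) :=
                mul_le_mul_of_nonneg_left
                  (Real.log_le_sub_one_of_pos (div_pos (hpos ω h) h)) h.le
            _ = T ω - p ω := by field_simp
    _ ≤ 0 := by rw [Finset.sum_sub_distrib]; linarith

theorem law_div_le_one [Fintype α] (X : Ω → α) (Z : Ω → γ) (c : γ) :
    ∑ a, law p (fun ω => (X ω, Z ω)) (a, c) / law p Z c ≤ 1 := by
  rw [← Finset.sum_div, sum_law_prod]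
  exact div_self_le_one _

/-- Gibbs' inequality for the joint law of the triple against `p(y,z) p(x|z)`. The sign is needed
later to replace `n` by `κ m` in front of an information. -/
theorem condMutualInfo_nonneg [Fintype α] [Fintype β] [Fintype γ] (hp : ∀ ω, 0 ≤ p ω)
    (X : Ω → α) (Y : Ω → β) (Z : Ω → γ) : 0 ≤ condMutualInfo p X Y Z := by
  set D : α × β × γ → ℝ := law p (fun ω => (X ω, Y ω, Z ω)) with hD
  set T : α × β × γ → ℝ := fun d => law p (fun ω => (Y ω, Z ω)) d.2 *
    (law p (fun ω => (X ω, Z ω)) (d.1, d.2.2) / law p Z d.2.2) with hT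
  have hDpos : ∀ d, 0 < D d → ∃ ω, 0 < p ω ∧ (X ω, Y ω, Z ω) = d := by
    classical
    intro d hd
    by_contra! h
    refine hd.ne' (Finset.sum_eq_zero fun ω _ => ?_)
    split_ifs with h'
    · exact le_antisymm (not_lt.1 fun h'' => h ω h'' h') (hp ω)
    · rfl
  have hTpos : ∀ d, 0 < D d → 0 < T d := by
    rintro d hd
    obtain ⟨ω, hω, rfl⟩ := hDpos d hd
    exact mul_pos (law_pos hp (fun ω => (Y ω, Z ω)) hω)
      (div_pos (law_pos hp (fun ω => (X ω, Z ω)) hω) (law_pos hp Z hω))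
  have key := sum_mul_log_div_nonpos (p := D) (T := T) (fun d => law_nonneg hp _ d)
    (fun d => mul_nonneg (law_nonneg hp _ _) (div_nonneg (law_nonneg hp _ _) (law_nonneg hp _ _)))
    hTpos ?_
  · rw [hD, sum_law_mul _ fun d => Real.log (T d / D d)] at key
    rw [condMutualInfo_eq, ← neg_nonpos, ← Finset.sum_neg_distrib]
    refine le_trans (le_of_eq (Finset.sum_congr rfl fun ω _ => ?_)) key
    rcases (hp ω).eq_or_lt with h | h
    · simp [← h]
    · have h1 := law_pos hp (fun ω => (X ω, Y ω, Z ω)) h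
      have h2 := law_pos hp (fun ω => (Y ω, Z ω)) h
      have h3 := law_pos hp (fun ω => (X ω, Z ω)) h
      have h4 := law_pos hp Z h
      simp only [hT, hD]
      rw [Real.log_div h1.ne' h2.ne', Real.log_div (mul_pos h2 (div_pos h3 h4)).ne' h1.ne',
        Real.log_mul h2.ne' (div_pos h3 h4).ne']
      ring
  · rw [Fintype.sum_prod_type, Finset.sum_comm, sum_law (p := p)]
    calc ∑ d : β × γ, ∑ a, T (a, d) ≤ ∑ d, law p (fun ω => (Y ω, Z ω)) d * 1 := by
          refine Finset.sum_le_sum fun d _ => ?_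
          simp only [hT]
          rw [← Finset.mul_sum]
          exact mul_le_mul_of_nonneg_left (law_div_le_one X Z d.2) (law_nonneg hp _ _)
      _ = ∑ ω, p ω := by simp only [mul_one]; rw [sum_law]

theorem law_mixture {V : Type*} [Fintype V] {l : V → ℝ} {P : V → Ω → ℝ} (X : Ω → α)
    (a : α) (v : V) :
    law (fun ω : V × Ω => l ω.1 * P ω.1 ω.2) (fun ω => (X ω.2, ω.1)) (a, v) =
      l v * law (P v) X a := by
  classical
  simp only [law, Prod.mk.injEq]
  rw [Fintype.sum_prod_type, Finset.sum_eq_single v]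
  · rw [Finset.mul_sum]
    exact Finset.sum_congr rfl fun ω _ => by simp
  · intro b _ hb
    simp [hb]
  · simp

/-- The weight `l v` cancels in both conditional probabilities once `v` is among the conditions.
This turns averages of informations into conditioning on a label, and back. -/
theorem condMutualInfo_mixture {V : Type*} [Fintype V] [Fintype α] [Fintype β] [Fintype γ]
    {l : V → ℝ} {P : V → Ω → ℝ} (X : Ω → α) (Y : Ω → β) (Z : Ω → γ) :
    condMutualInfo (fun ω : V × Ω => l ω.1 * P ω.1 ω.2) (fun ω => X ω.2) (fun ω => Y ω.2)
      (fun ω => (Z ω.2, ω.1)) = ∑ v, l v * condMutualInfo (P v) X Y Z := by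
  rw [condMutualInfo_eq, Fintype.sum_prod_type]
  refine Finset.sum_congr rfl fun v _ => ?_
  rw [condMutualInfo_eq, Finset.mul_sum]
  refine Finset.sum_congr rfl fun ω _ => ?_
  dsimp only
  by_cases h : l v = 0
  · simp [h]
  rw [law_congr (X' := fun ω : V × Ω => ((X ω.2, Y ω.2, Z ω.2), ω.1))
      (b := ((X ω, Y ω, Z ω), v)) fun ω => by simp [and_assoc],
    law_congr (X := fun ω : V × Ω => (Y ω.2, Z ω.2, ω.1))
      (X' := fun ω : V × Ω => ((Y ω.2, Z ω.2), ω.1))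
      (b := ((Y ω, Z ω), v)) fun ω => by simp [and_assoc],
    law_congr (X := fun ω : V × Ω => (X ω.2, Z ω.2, ω.1))
      (X' := fun ω : V × Ω => ((X ω.2, Z ω.2), ω.1))
      (b := ((X ω, Z ω), v)) fun ω => by simp [and_assoc],
    law_mixture (fun ω => (X ω, Y ω, Z ω)), law_mixture (fun ω => (Y ω, Z ω)),
    law_mixture (fun ω => (X ω, Z ω)), law_mixture Z, mul_div_mul_left _ _ h,
    mul_div_mul_left _ _ h, mul_assoc]

theorem continuous_entropy [Fintype α] {T : Type*} [TopologicalSpace T] {f : T → Ω → ℝ}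
    (hf : ∀ ω, Continuous fun t => f t ω) (X : Ω → α) :
    Continuous fun t => entropy (f t) X := by
  have h : ∀ a, Continuous fun t => law (f t) X a := fun a => by
    unfold law
    refine continuous_finsetSum _ fun ω _ => ?_
    split_ifs
    · exact hf ω
    · exact continuous_const
  unfold entropy
  exact (continuous_finsetSum _ fun a _ => Real.continuous_mul_log.comp (h a)).neg

/-- Quotients of probabilities are not continuous at zero, so the information is first rewritten
through joint entropies, where only the continuous function `t log t` occurs. -/
theorem continuous_condMutualInfo [Fintype α] [Fintype β] [Fintype γ] {T : Type*}
    [TopologicalSpace T] {f : T → Ω → ℝ}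
    (hf : ∀ ω, Continuous fun t => f t ω) (h0 : ∀ t ω, 0 ≤ f t ω)
    (X : Ω → α) (Y : Ω → β) (Z : Ω → γ) :
    Continuous fun t => condMutualInfo (f t) X Y Z := by
  simp only [condMutualInfo, condEntropy_eq_sub (h0 _)]
  exact ((continuous_entropy hf _).sub (continuous_entropy hf _)).sub
    ((continuous_entropy hf _).sub (continuous_entropy hf _))

end Law

/-! ### Processes given by causal kernels. -/

section Causal

variable {Z O : Type*}

/-- The first `k` entries of a sequence. -/
def past {n : ℕ} (z : Fin n → Z) (k : Fin n) : Fin (k : ℕ) → Z :=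
  fun j => z (Fin.castLE k.isLt.le j)

theorem past_cons_succ {n : ℕ} (a : Z) (z : Fin n → Z) (k : Fin n) :
    past (Fin.cons a z : Fin (n + 1) → Z) k.succ =
      (Fin.cons a (past z k) : Fin ((k : ℕ) + 1) → Z) := by
  funext j
  refine Fin.cases ?_ (fun i => ?_) j <;> rfl

theorem past_zero {n : ℕ} (z : Fin (n + 1) → Z) : past z 0 = Fin.elim0 :=
  funext fun j => j.elim0

variable [Fintype Z]

theorem sum_fin_succ {n : ℕ} (f : (Fin (n + 1) → Z) → ℝ) :
    ∑ z, f z = ∑ a, ∑ z : Fin n → Z, f (Fin.cons a z) := by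
  rw [← (Fin.consEquiv fun _ : Fin (n + 1) => Z).sum_comp, Fintype.sum_prod_type]
  rfl

/-- The law of a process with kernels `K` has total mass one. -/
theorem sum_prod_kernel {n : ℕ} (K : (k : Fin n) → (Fin (k : ℕ) → Z) → Z → ℝ)
    (hK : ∀ k h, ∑ a, K k h a = 1) :
    ∑ z : Fin n → Z, ∏ k, K k (past z k) (z k) = 1 := by
  induction n with
  | zero => simp
  | succ n ih =>
    rw [sum_fin_succ]
    simp only [Fin.prod_univ_succ, past_zero, past_cons_succ, Fin.cons_zero, Fin.cons_succ]
    simp only [← Finset.mul_sum]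
    rw [← hK 0 Fin.elim0]
    refine Finset.sum_congr rfl fun a _ => ?_
    rw [ih (fun k h b => K k.succ (Fin.cons a h : Fin ((k : ℕ) + 1) → Z) b) fun k h => hK _ _,
      mul_one]

/-- Given the past, the `k`-th letter of a process with kernels `K` has law `K k`. -/
theorem sum_prod_kernel_mul {n : ℕ} (K : (k : Fin n) → (Fin (k : ℕ) → Z) → Z → ℝ)
    (hK : ∀ k h, ∑ a, K k h a = 1) (k : Fin n) (F : (Fin (k : ℕ) → Z) → Z → ℝ) :
    ∑ z : Fin n → Z, (∏ j, K j (past z j) (z j)) * F (past z k) (z k) =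
      ∑ z : Fin n → Z, (∏ j, K j (past z j) (z j)) * ∑ a, K k (past z k) a * F (past z k) a := by
  induction n with
  | zero => exact k.elim0
  | succ n ih =>
    rw [sum_fin_succ, sum_fin_succ]
    have hone := fun a => sum_prod_kernel
      (fun (k : Fin n) h b => K k.succ (Fin.cons a h : Fin ((k : ℕ) + 1) → Z) b) fun k h => hK _ _
    refine Fin.cases (fun F => ?_) (fun k F => ?_) k F
    · simp only [Fin.prod_univ_succ, past_zero, past_cons_succ, Fin.cons_zero, Fin.cons_succ,
        ← Finset.sum_mul, ← Finset.mul_sum, hone, mul_one]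
      exact ((congrArg (· * _) (hK 0 Fin.elim0)).trans (one_mul _)).symm
    · simp only [Fin.prod_univ_succ, past_zero, past_cons_succ, Fin.cons_zero, Fin.cons_succ,
        mul_assoc, ← Finset.mul_sum]
      refine Finset.sum_congr rfl fun a _ => ?_
      congr 1
      exact ih (fun k h b => K k.succ (Fin.cons a h : Fin ((k : ℕ) + 1) → Z) b)
        (fun k h => hK _ _) k fun h b => F (Fin.cons a h : Fin ((k : ℕ) + 1) → Z) b

open scoped Classical in
/-- Summing a process over the letters with given images under `f`: if the kernels factor as
`q (f-past, f z) * r (past, z)` and `r` is a sub-probability on every fibre of `f`, then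
the image process is dominated by the process with kernels `q`. -/
theorem sum_prod_kernel_le [Fintype O] (f : Z → O) {n : ℕ}
    (q : (k : Fin n) → (Fin (k : ℕ) → O) → O → ℝ)
    (r : (k : Fin n) → (Fin (k : ℕ) → Z) → Z → ℝ)
    (hq : ∀ k h o, 0 ≤ q k h o)
    (hr0 : ∀ k h z, 0 ≤ r k h z)
    (hr1 : ∀ k h o, ∑ z, (if f z = o then r k h z else 0) ≤ 1)
    (φ : (Fin n → O) → ℝ) (hφ : ∀ o, 0 ≤ φ o) :
    ∑ z : Fin n → Z, (∏ k, q k (fun j => f (past z k j)) (f (z k)) * r k (past z k) (z k)) *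
        φ (fun k => f (z k)) ≤
      ∑ o : Fin n → O, (∏ k, q k (past o k) (o k)) * φ o := by
  induction n with
  | zero =>
    have h1 : (fun k : Fin 0 => f ((default : Fin 0 → Z) k)) = default := Subsingleton.elim _ _
    simp [h1]
  | succ n ih =>
    rw [sum_fin_succ, sum_fin_succ]
    have hcons : ∀ (m : ℕ) (a : Z) (z : Fin m → Z),
        (fun j => f ((Fin.cons a z : Fin (m + 1) → Z) j)) =
          (Fin.cons (f a) (fun j => f (z j)) : Fin (m + 1) → O) := by
      intro m a z
      funext j
      refine Fin.cases ?_ (fun i => ?_) j <;> rfl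
    have helim : (fun j => f ((Fin.elim0 : Fin 0 → Z) j)) = (Fin.elim0 : Fin 0 → O) :=
      funext fun j => j.elim0
    set N : O → ℝ := fun b => ∑ o : Fin n → O,
      (∏ k : Fin n, q k.succ (Fin.cons b (past o k) : Fin ((k : ℕ) + 1) → O) (o k)) *
        φ (Fin.cons b o) with hN
    have hN0 : ∀ b, 0 ≤ N b := fun b => Finset.sum_nonneg fun o _ =>
      mul_nonneg (Finset.prod_nonneg fun k _ => hq _ _ _) (hφ _)
    simp only [Fin.prod_univ_succ, past_zero, past_cons_succ, Fin.cons_zero, Fin.cons_succ,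
      hcons, mul_assoc, ← Finset.mul_sum, Fin.val_succ, Fin.val_zero, helim]
    simp only [← mul_assoc]
    -- Induction on the tail with the first letter frozen in the kernels. The resulting bound `N`
    -- sees that letter only through `f a`, so its fibre can be summed against `r`.
    calc _ ≤ ∑ a, q 0 Fin.elim0 (f a) * r 0 Fin.elim0 a * N (f a) := by
          refine Finset.sum_le_sum fun a _ => ?_
          refine mul_le_mul_of_nonneg_left ?_ (mul_nonneg (hq _ _ _) (hr0 _ _ _))
          exact ih (fun k h b => q k.succ (Fin.cons (f a) h : Fin ((k : ℕ) + 1) → O) b)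
            (fun k h b => r k.succ (Fin.cons a h : Fin ((k : ℕ) + 1) → Z) b)
            (fun k h o => hq _ _ _) (fun k h o => hr0 _ _ _) (fun k h o => hr1 _ _ _)
            (fun o => φ (Fin.cons (f a) o)) fun o => hφ _
      _ = ∑ o, ∑ a, q 0 Fin.elim0 o * N o * (if f a = o then r 0 Fin.elim0 a else 0) := by
          rw [Finset.sum_comm]
          refine Finset.sum_congr rfl fun a _ => ?_
          simp only [mul_ite, mul_zero, Finset.sum_ite_eq, Finset.mem_univ, if_true]
          ring
      _ ≤ ∑ o, q 0 Fin.elim0 o * N o := by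
          refine Finset.sum_le_sum fun o _ => ?_
          rw [← Finset.mul_sum]
          exact mul_le_of_le_one_right (mul_nonneg (hq _ _ _) (hN0 o)) (hr1 _ _ _)

end Causal

/-! ### The block converse by one Gibbs inequality. -/

section Converse

-- The conditional law of `z` given `f z = o`. It is only a sub-probability because division by zero
-- gives `0` when `o` has no mass; an inequality is all that the mass bound for the test measure
-- needs.
open scoped Classical in
theorem sum_fibre_div_law_le_one {Z O : Type*} [Fintype Z] (p : Z → ℝ) (f : Z → O) (o : O) :
    ∑ z, (if f z = o then p z / law p f (f z) else 0) ≤ 1 := by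
  calc _ = law p f o / law p f o := by
        conv_rhs => arg 1; unfold law
        rw [Finset.sum_div]
        refine Finset.sum_congr rfl fun z _ => ?_
        split_ifs with h
        · rw [h]
        · simp
    _ ≤ 1 := div_self_le_one _

theorem sum_prod_le_one {O : Type*} [Fintype O] {n : ℕ}
    (q : (k : Fin n) → (Fin (k : ℕ) → O) → O → ℝ) (hq : ∀ k h o, 0 ≤ q k h o)
    (hq1 : ∀ k h, ∑ o, q k h o ≤ 1) : ∑ o : Fin n → O, ∏ k, q k (past o k) (o k) ≤ 1 := by
  have h := sum_prod_kernel_le (fun _ : O => ()) (n := n) (fun _ _ _ => 1) q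
    (fun _ _ _ => zero_le_one) hq (fun k h _ => by simpa using hq1 k h) (fun _ => 1)
    fun _ => zero_le_one
  simpa using h

open scoped Classical in
/-- The test distribution behind Fano's inequality: with probability one half the guess `d`,
otherwise uniform. -/
noncomputable def fanoWeight {A : Type*} [Fintype A] (d a : A) : ℝ :=
  1 / 2 * ((if a = d then 1 else 0) + 1 / (Fintype.card A : ℝ))

theorem fanoWeight_pos {A : Type*} [Fintype A] (d a : A) : 0 < fanoWeight d a := by
  have : 0 < (Fintype.card A : ℝ) := Nat.cast_pos.2 (Fintype.card_pos_iff.2 ⟨d⟩)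
  unfold fanoWeight
  split_ifs <;> positivity

open scoped Classical in
theorem sum_fanoWeight {A : Type*} [Fintype A] (d : A) : ∑ a, fanoWeight d a = 1 := by
  have : (Fintype.card A : ℝ) ≠ 0 := Nat.cast_ne_zero.2 (Fintype.card_pos_iff.2 ⟨d⟩).ne'
  have h : ∑ a, (if a = d then (1 : ℝ) else 0) = 1 := by simp
  simp only [fanoWeight]
  rw [← Finset.mul_sum, Finset.sum_add_distrib, Finset.sum_const, nsmul_eq_mul,
    Finset.card_univ, mul_one_div_cancel this]
  norm_num [h]

-- Fano's inequality pointwise: a correct guess has test weight at least `1 / 2`, a wrong one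
-- exactly `1 / (2 |A|)`.
open scoped Classical in
theorem log_fanoWeight_ge {A : Type*} [Fintype A] (d a : A) :
    -Real.log 2 - (if d ≠ a then 1 else 0) * Real.log (Fintype.card A) ≤
      Real.log (fanoWeight d a) := by
  have h0 : 0 < (Fintype.card A : ℝ) := Nat.cast_pos.2 (Fintype.card_pos_iff.2 ⟨d⟩)
  by_cases h : d = a
  · simp only [h, ne_eq, not_true, if_false, zero_mul, sub_zero, ← Real.log_inv]
    refine Real.log_le_log (by norm_num) ?_
    have : 0 < 1 / (Fintype.card A : ℝ) := by positivity
    simp only [fanoWeight, if_true]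
    linarith
  · simp only [fanoWeight, ne_eq, h, Ne.symm h, not_false_eq_true, if_true, if_false, one_mul,
      zero_add]
    rw [Real.log_mul (by norm_num) (by positivity), Real.log_div one_ne_zero two_ne_zero,
      Real.log_div one_ne_zero h0.ne', Real.log_one]
    linarith

variable {σ X Z ι : Type*} {m n : ℕ}

/-- The joint law of an i.i.d. source sequence with p.m.f. `Q` and of the output sequence of a
memoryless channel `W` whose inputs are causal functions of source and past outputs. -/
def processLaw (Q : σ → ℝ) (W : X → Z → ℝ)
    (x : (k : Fin n) → (Fin m → σ) → (Fin (k : ℕ) → Z) → X)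
    (ω : (Fin m → σ) × (Fin n → Z)) : ℝ :=
  (∏ i, Q (ω.1 i)) * ∏ k, W (x k ω.1 (past ω.2 k)) (ω.2 k)

/-- The law of label and channel input at a uniformly chosen time. -/
noncomputable def labelInputLaw [Fintype σ] [Fintype Z] (Q : σ → ℝ) (W : X → Z → ℝ)
    (x : (k : Fin n) → (Fin m → σ) → (Fin (k : ℕ) → Z) → X)
    (l : (k : Fin n) → (Fin m → σ) → (Fin (k : ℕ) → Z) → ι) (d : ι × X) : ℝ :=
  (n : ℝ)⁻¹ * ∑ k, law (processLaw Q W x)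
    (fun ω => (l k ω.1 (past ω.2 k), x k ω.1 (past ω.2 k))) d

/-- The law of label, channel input and channel output for a given law of label and input. -/
def labelIOLaw (W : X → Z → ℝ) (μ : ι × X → ℝ) (ω : ι × X × Z) : ℝ :=
  μ (ω.1, ω.2.1) * W ω.2.1 ω.2.2

variable {Q : σ → ℝ} {W : X → Z → ℝ}
  {x : (k : Fin n) → (Fin m → σ) → (Fin (k : ℕ) → Z) → X}
  {l : (k : Fin n) → (Fin m → σ) → (Fin (k : ℕ) → Z) → ι}

theorem processLaw_nonneg (hQ0 : ∀ s, 0 ≤ Q s) (hW0 : ∀ x z, 0 ≤ W x z)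
    (ω : (Fin m → σ) × (Fin n → Z)) : 0 ≤ processLaw Q W x ω :=
  mul_nonneg (Finset.prod_nonneg fun _ _ => hQ0 _) (Finset.prod_nonneg fun _ _ => hW0 _ _)

variable [Fintype σ] [Fintype Z]

theorem sum_processLaw_source (hW1 : ∀ x, ∑ z, W x z = 1) (f : (Fin m → σ) → ℝ) :
    ∑ ω, processLaw Q W x ω * f ω.1 = ∑ s : Fin m → σ, (∏ i, Q (s i)) * f s := by
  rw [Fintype.sum_prod_type]
  refine Finset.sum_congr rfl fun s _ => ?_
  simp only [processLaw]
  rw [← Finset.sum_mul, ← Finset.mul_sum,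
    sum_prod_kernel (fun k h z => W (x k s h) z) fun k h => hW1 _, mul_one]

theorem sum_processLaw (hQ1 : ∑ s, Q s = 1) (hW1 : ∀ x, ∑ z, W x z = 1) :
    ∑ ω, processLaw Q W x ω = 1 := by
  have h := sum_processLaw_source (Q := Q) (x := x) hW1 fun _ => 1
  simp only [mul_one] at h
  rw [h, sum_prod_kernel (fun _ _ s => Q s) fun _ _ => hQ1]

theorem sum_processLaw_source_apply (hQ1 : ∑ s, Q s = 1) (hW1 : ∀ x, ∑ z, W x z = 1)
    (i : Fin m) (f : σ → ℝ) :
    ∑ ω, processLaw Q W x ω * f (ω.1 i) = ∑ s, Q s * f s := by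
  rw [sum_processLaw_source hW1 fun s => f (s i),
    sum_prod_kernel_mul (fun _ _ s => Q s) (fun _ _ => hQ1) i fun _ s => f s, ← Finset.sum_mul,
    sum_prod_kernel (fun _ _ s => Q s) fun _ _ => hQ1, one_mul]

theorem labelInputLaw_nonneg (hQ0 : ∀ s, 0 ≤ Q s) (hW0 : ∀ x z, 0 ≤ W x z) (d : ι × X) :
    0 ≤ labelInputLaw Q W x l d :=
  mul_nonneg (by positivity)
    (Finset.sum_nonneg fun k _ => law_nonneg (processLaw_nonneg hQ0 hW0) _ _)

/-- Used to see that, on the support, the relay input is a function of the label. -/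
theorem exists_of_labelInputLaw_pos {d : ι × X} (h : 0 < labelInputLaw Q W x l d) :
    ∃ k s h, (l k s h, x k s h) = d := by
  classical
  by_contra! h'
  refine h.ne' ?_
  simp only [labelInputLaw, law]
  simp [h']

variable [Fintype X] [Fintype ι]

theorem sum_labelInputLaw_mul (hn : n ≠ 0) (f : ι × X → ℝ) :
    n * ∑ d, labelInputLaw Q W x l d * f d =
      ∑ k, ∑ ω, processLaw Q W x ω * f (l k ω.1 (past ω.2 k), x k ω.1 (past ω.2 k)) := by
  have hn' : (n : ℝ) ≠ 0 := Nat.cast_ne_zero.2 hn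
  simp only [labelInputLaw, mul_assoc]
  rw [← Finset.mul_sum, mul_inv_cancel_left₀ hn']
  simp only [Finset.sum_mul]
  rw [Finset.sum_comm]
  refine Finset.sum_congr rfl fun k _ => ?_
  rw [sum_law_mul]

theorem sum_labelInputLaw (hn : n ≠ 0) (hQ1 : ∑ s, Q s = 1) (hW1 : ∀ x, ∑ z, W x z = 1) :
    ∑ d, labelInputLaw Q W x l d = 1 := by
  have hn' : (n : ℝ) ≠ 0 := Nat.cast_ne_zero.2 hn
  have h := sum_labelInputLaw_mul (Q := Q) (W := W) (x := x) (l := l) hn fun _ => 1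
  simp only [mul_one, sum_processLaw hQ1 hW1, Finset.sum_const, Finset.card_univ,
    Fintype.card_fin, nsmul_eq_mul] at h
  exact mul_left_cancel₀ hn' (by rw [h, mul_one])

/-- Single-letterization: given the past, the `k`-th output has law `W` at the current input, so a
sum over time of expectations is `n` times one expectation under the time-averaged law. -/
theorem sum_labelIOLaw_mul (hn : n ≠ 0) (hW1 : ∀ x, ∑ z, W x z = 1) (f : ι → X → Z → ℝ) :
    n * ∑ ω, labelIOLaw W (labelInputLaw Q W x l) ω * f ω.1 ω.2.1 ω.2.2 =
      ∑ ω, processLaw Q W x ω *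
        ∑ k, f (l k ω.1 (past ω.2 k)) (x k ω.1 (past ω.2 k)) (ω.2 k) := by
  have h1 : ∑ ω, labelIOLaw W (labelInputLaw Q W x l) ω * f ω.1 ω.2.1 ω.2.2 =
      ∑ d, labelInputLaw Q W x l d * ∑ z, W d.2 z * f d.1 d.2 z := by
    simp only [Fintype.sum_prod_type, labelIOLaw, Finset.mul_sum, mul_assoc]
  rw [h1, sum_labelInputLaw_mul hn fun d => ∑ z, W d.2 z * f d.1 d.2 z]
  have h2 : ∑ ω, processLaw Q W x ω *
      ∑ k, f (l k ω.1 (past ω.2 k)) (x k ω.1 (past ω.2 k)) (ω.2 k) =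
      ∑ k, ∑ ω, processLaw Q W x ω *
        f (l k ω.1 (past ω.2 k)) (x k ω.1 (past ω.2 k)) (ω.2 k) := by
    rw [Finset.sum_comm]
    simp only [Finset.mul_sum]
  rw [h2]
  refine Finset.sum_congr rfl fun k _ => ?_
  rw [Fintype.sum_prod_type, Fintype.sum_prod_type]
  refine Finset.sum_congr rfl fun s _ => ?_
  simp only [processLaw, mul_assoc, ← Finset.mul_sum]
  congr 1
  exact (sum_prod_kernel_mul (fun k h z => W (x k s h) z) (fun k h => hW1 _) k
    fun h z => f (l k s h) (x k s h) z).symm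

/-- If `R` and `C` determine the input given the label, then the information between `R` and the
output `O` given `C` and the label is governed by the channel law of `O`. -/
theorem condMutualInfo_labelIOLaw {𝒪 υ ρ : Type*} [Fintype 𝒪] [Fintype υ] [Fintype ρ]
    {μ : ι × X → ℝ} (hμ : ∀ d, 0 ≤ μ d) (hW0 : ∀ x z, 0 ≤ W x z) (hW1 : ∀ x, ∑ z, W x z = 1)
    (R : X → ρ) (O : Z → 𝒪) (U : X → υ)
    (hinj : ∀ i x x', 0 < μ (i, x) → 0 < μ (i, x') → R x = R x' → U x = U x' → x = x') :
    condMutualInfo (labelIOLaw W μ) (fun ω => R ω.2.1) (fun ω => O ω.2.2)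
        (fun ω => (U ω.2.1, ω.1)) =
      ∑ ω, labelIOLaw W μ ω * (Real.log (law (W ω.2.1) O (O ω.2.2)) -
        Real.log (law (labelIOLaw W μ) (fun ω => (O ω.2.2, U ω.2.1, ω.1))
            (O ω.2.2, U ω.2.1, ω.1) /
          law (labelIOLaw W μ) (fun ω => (U ω.2.1, ω.1)) (U ω.2.1, ω.1))) := by
  classical
  have hJ0 : ∀ ω, 0 ≤ labelIOLaw W μ ω := fun ω => mul_nonneg (hμ _) (hW0 _ _)
  rw [condMutualInfo_eq]
  refine Finset.sum_congr rfl fun ω _ => ?_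
  rcases (hJ0 ω).eq_or_lt with h0 | h0
  · simp [← h0]
  congr 1
  have hμω : 0 < μ (ω.1, ω.2.1) := (hμ _).lt_of_ne fun h => h0.ne (by simp [labelIOLaw, ← h])
  -- Only one input of positive mass is compatible with the given `R`, `U` and label, so the sums
  -- over inputs below collapse to one term.
  have hinj' : ∀ x', R x' = R ω.2.1 → U x' = U ω.2.1 → x' ≠ ω.2.1 → μ (ω.1, x') = 0 := by
    intro x' h1 h2 h3
    by_contra h4
    exact h3 (hinj ω.1 _ _ ((hμ _).lt_of_ne (Ne.symm h4)) hμω h1 h2)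
  have hRC : law (labelIOLaw W μ) (fun ω => (R ω.2.1, U ω.2.1, ω.1)) (R ω.2.1, U ω.2.1, ω.1) =
      μ (ω.1, ω.2.1) := by
    simp only [law, Prod.mk.injEq, Fintype.sum_prod_type]
    rw [Finset.sum_eq_single ω.1 (fun i _ hi => by simp [hi]) (by simp),
      Finset.sum_eq_single ω.2.1 (fun x' _ hx => ?_) (by simp)]
    · simp [labelIOLaw, ← Finset.mul_sum, hW1]
    · refine Finset.sum_eq_zero fun z _ => ?_
      split_ifs with h
      · simp [labelIOLaw, hinj' x' h.1 h.2.1 hx]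
      · rfl
  have hROC : law (labelIOLaw W μ) (fun ω => (R ω.2.1, O ω.2.2, U ω.2.1, ω.1))
      (R ω.2.1, O ω.2.2, U ω.2.1, ω.1) = μ (ω.1, ω.2.1) * law (W ω.2.1) O (O ω.2.2) := by
    simp only [law, Prod.mk.injEq, Fintype.sum_prod_type]
    rw [Finset.sum_eq_single ω.1 (fun i _ hi => by simp [hi]) (by simp),
      Finset.sum_eq_single ω.2.1 (fun x' _ hx => ?_) (by simp)]
    · simp [labelIOLaw, Finset.mul_sum]
    · refine Finset.sum_eq_zero fun z _ => ?_
      split_ifs with h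
      · simp [labelIOLaw, hinj' x' h.1 h.2.2.1 hx]
      · rfl
  have h1 := law_pos hJ0 (fun ω => (O ω.2.2, U ω.2.1, ω.1)) h0
  have h2 := law_pos hJ0 (fun ω => (U ω.2.1, ω.1)) h0
  have h3 := law_pos hJ0 (fun ω => (R ω.2.1, O ω.2.2, U ω.2.1, ω.1)) h0
  have h4 : 0 < law (W ω.2.1) O (O ω.2.2) := by
    rw [hROC] at h3
    exact (pos_iff_pos_of_mul_pos h3).1 hμω
  rw [hRC, Real.log_div h3.ne' h1.ne', Real.log_div hμω.ne' h2.ne', Real.log_div h1.ne' h2.ne',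
    hROC, Real.log_mul hμω.ne' h4.ne']
  ring

open scoped Classical in
/-- The converse: a decoder that recovers `A` of the source letters from the outputs
`O` and side information `B` bounds `H(A | B)` by the information that the channel conveys. -/
theorem converse_bound {𝒪 υ ρ α β : Type*} [Fintype 𝒪] [Fintype υ] [Fintype ρ] [Fintype α]
    [Fintype β] (hn : n ≠ 0) (hQ0 : ∀ s, 0 ≤ Q s) (hQ1 : ∑ s, Q s = 1)
    (hW0 : ∀ x z, 0 ≤ W x z) (hW1 : ∀ x, ∑ z, W x z = 1)
    (A : σ → α) (B : σ → β) (R : X → ρ) (O : Z → 𝒪) (U : X → υ)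
    (hinj : ∀ i x' x'', 0 < labelInputLaw Q W x l (i, x') → 0 < labelInputLaw Q W x l (i, x'') →
      R x' = R x'' → U x' = U x'' → x' = x'')
    (c : (k : Fin n) → (Fin (k : ℕ) → 𝒪) → (Fin m → β) → υ × ι)
    (hc : ∀ k s h, (U (x k s h), l k s h) = c k (fun j => O (h j)) (fun i => B (s i)))
    (dec : (Fin n → 𝒪) → (Fin m → β) → Fin m → α) :
    m * condEntropy Q A B ≤
      n * condMutualInfo (labelIOLaw W (labelInputLaw Q W x l)) (fun ω => R ω.2.1)
        (fun ω => O ω.2.2) (fun ω => (U ω.2.1, ω.1)) + Real.log 2 +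
      (∑ ω, processLaw Q W x ω *
        if dec (fun k => O (ω.2 k)) (fun i => B (ω.1 i)) ≠ (fun i => A (ω.1 i)) then 1 else 0) *
        (m * Real.log (Fintype.card α)) := by
  set J := labelIOLaw W (labelInputLaw Q W x l) with hJ
  set P := processLaw Q W x with hP
  have hμ0 : ∀ d, 0 ≤ labelInputLaw Q W x l d := labelInputLaw_nonneg hQ0 hW0
  have hJ0 : ∀ ω, 0 ≤ J ω := fun ω => mul_nonneg (hμ0 _) (hW0 _ _)
  have hP0 : ∀ ω, 0 ≤ P ω := processLaw_nonneg hQ0 hW0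
  set q : υ × ι → 𝒪 → ℝ := fun u o => law J (fun ω => (O ω.2.2, U ω.2.1, ω.1)) (o, u) /
    law J (fun ω => (U ω.2.1, ω.1)) u with hq
  have hq0 : ∀ u o, 0 ≤ q u o := fun u o => div_nonneg (law_nonneg hJ0 _ _) (law_nonneg hJ0 _ _)
  have hq1 : ∀ u, ∑ o, q u o ≤ 1 := fun u =>
    law_div_le_one (fun ω : ι × X × Z => O ω.2.2) (fun ω => (U ω.2.1, ω.1)) u
  set r : X → Z → ℝ := fun x z => W x z / law (W x) O (O z) with hr
  have hr0 : ∀ x z, 0 ≤ r x z := fun x z => div_nonneg (hW0 _ _) (law_nonneg (hW0 x) _ _)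
  set LB : β → ℝ := law Q B with hLB
  set LAB : α × β → ℝ := law Q (fun s => (A s, B s)) with hLAB
  have hLB0 : ∀ b, 0 ≤ LB b := law_nonneg hQ0 _
  have hLAB0 : ∀ d, 0 ≤ LAB d := law_nonneg hQ0 _
  -- The test measure: `LB` replaces the law of `(A, B)` by that of `B`, `q` replaces the channel
  -- law of the observation, and `fanoWeight` supplies `A`. The quotients are the true conditional
  -- laws given `(A, B)` and given the observation, so they cancel in `T / P`.
  set T : (Fin m → σ) × (Fin n → Z) → ℝ := fun ω =>
    (∏ i, LB (B (ω.1 i)) * (Q (ω.1 i) / LAB (A (ω.1 i), B (ω.1 i)))) *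
      ((∏ k, q (U (x k ω.1 (past ω.2 k)), l k ω.1 (past ω.2 k)) (O (ω.2 k)) *
          r (x k ω.1 (past ω.2 k)) (ω.2 k)) *
        fanoWeight (dec (fun k => O (ω.2 k)) (fun i => B (ω.1 i))) (fun i => A (ω.1 i))) with hT
  have hw0 : ∀ s : Fin m → σ, 0 ≤ ∏ i, LB (B (s i)) * (Q (s i) / LAB (A (s i), B (s i))) :=
    fun s => Finset.prod_nonneg fun i _ => mul_nonneg (hLB0 _) (div_nonneg (hQ0 _) (hLAB0 _))
  have hT0 : ∀ ω, 0 ≤ T ω := fun ω => mul_nonneg (hw0 _)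
    (mul_nonneg (Finset.prod_nonneg fun k _ => mul_nonneg (hq0 _ _) (hr0 _ _))
      (fanoWeight_pos _ _).le)
  -- the total mass of the test distribution
  have hT1 : ∑ ω, T ω ≤ ∑ ω, P ω := by
    rw [hP, sum_processLaw hQ1 hW1, Fintype.sum_prod_type]
    simp only [hT, ← Finset.mul_sum]
    -- Order of summation: outputs down to observations (possible by `hc`), sources down to `(A,
    -- B)`, then `A` for fixed observations, then observations, then `B`.
    calc _ ≤ ∑ s : Fin m → σ, (∏ i, LB (B (s i)) * (Q (s i) / LAB (A (s i), B (s i)))) *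
          ∑ o : Fin n → 𝒪, (∏ k, q (c k (past o k) fun i => B (s i)) (o k)) *
            fanoWeight (dec o fun i => B (s i)) (fun i => A (s i)) := by
          refine Finset.sum_le_sum fun s _ => mul_le_mul_of_nonneg_left ?_ (hw0 s)
          simp only [hc]
          exact sum_prod_kernel_le O (fun k h o => q (c k h fun i => B (s i)) o)
            (fun k h z => r (x k s h) z) (fun k h o => hq0 _ _) (fun k h z => hr0 _ _)
            (fun k h o => sum_fibre_div_law_le_one (W (x k s h)) O o)
            (fun o => fanoWeight (dec o fun i => B (s i)) (fun i => A (s i)))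
            fun o => (fanoWeight_pos _ _).le
      _ ≤ ∑ d : Fin m → α × β, (∏ i, LB (d i).2) *
          ∑ o : Fin n → 𝒪, (∏ k, q (c k (past o k) fun i => (d i).2) (o k)) *
            fanoWeight (dec o fun i => (d i).2) (fun i => (d i).1) :=
          sum_prod_kernel_le (fun s => (A s, B s)) (fun _ _ d => LB d.2)
            (fun _ _ s => Q s / LAB (A s, B s)) (fun _ _ _ => hLB0 _)
            (fun _ _ _ => div_nonneg (hQ0 _) (hLAB0 _))
            (fun _ _ d => sum_fibre_div_law_le_one Q (fun s => (A s, B s)) d)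
            (fun d => ∑ o : Fin n → 𝒪, (∏ k, q (c k (past o k) fun i => (d i).2) (o k)) *
              fanoWeight (dec o fun i => (d i).2) (fun i => (d i).1))
            fun d => Finset.sum_nonneg fun o _ => mul_nonneg
              (Finset.prod_nonneg fun k _ => hq0 _ _) (fanoWeight_pos _ _).le
      _ = ∑ b : Fin m → β, (∏ i, LB (b i)) *
          ∑ o : Fin n → 𝒪, ∏ k, q (c k (past o k) b) (o k) := by
          rw [← (Equiv.arrowProdEquivProdArrow (Fin m) (fun _ => α) (fun _ => β)).symm.sum_comp,
            Fintype.sum_prod_type, Finset.sum_comm]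
          refine Finset.sum_congr rfl fun b _ => ?_
          simp only [Equiv.arrowProdEquivProdArrow, Equiv.coe_fn_symm_mk]
          rw [← Finset.mul_sum, Finset.sum_comm]
          simp only [← Finset.mul_sum]
          exact congrArg _ (Finset.sum_congr rfl fun o _ =>
            (congrArg _ (sum_fanoWeight _)).trans (mul_one _))
      _ ≤ ∑ b : Fin m → β, (∏ i, LB (b i)) * 1 := by
          refine Finset.sum_le_sum fun b _ => mul_le_mul_of_nonneg_left ?_
            (Finset.prod_nonneg fun i _ => hLB0 _)
          exact sum_prod_le_one (fun k h o => q (c k h b) o) (fun _ _ _ => hq0 _ _)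
            fun _ _ => hq1 _
      _ = 1 := by
          simp only [mul_one]
          exact sum_prod_kernel (fun _ _ b => LB b) fun _ _ => by rw [hLB, sum_law, hQ1]
  -- positivity and the logarithm of the likelihood ratio on the support
  have hsupp : ∀ ω, 0 < P ω → (∀ i, 0 < Q (ω.1 i)) ∧
      ∀ k, 0 < W (x k ω.1 (past ω.2 k)) (ω.2 k) := by
    intro ω hω
    rw [hP, processLaw] at hω
    have h1 := left_ne_zero_of_mul hω.ne'
    have h2 := right_ne_zero_of_mul hω.ne'
    rw [Finset.prod_ne_zero_iff] at h1 h2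
    exact ⟨fun i => (hQ0 _).lt_of_ne (h1 i (Finset.mem_univ _)).symm,
      fun k => (hW0 _ _).lt_of_ne (h2 k (Finset.mem_univ _)).symm⟩
  have hqpos : ∀ ω, 0 < P ω → ∀ k,
      0 < q (U (x k ω.1 (past ω.2 k)), l k ω.1 (past ω.2 k)) (O (ω.2 k)) := by
    intro ω hω k
    have hμ : 0 < labelInputLaw Q W x l (l k ω.1 (past ω.2 k), x k ω.1 (past ω.2 k)) := by
      refine mul_pos (by positivity) (lt_of_lt_of_le
        (law_pos hP0 (fun ω => (l k ω.1 (past ω.2 k), x k ω.1 (past ω.2 k))) hω) ?_)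
      exact Finset.single_le_sum (f := fun k => law P
        (fun ω => (l k ω.1 (past ω.2 k), x k ω.1 (past ω.2 k))) _)
        (fun k' _ => law_nonneg hP0 _ _) (Finset.mem_univ k)
    have hJpos : 0 < J (l k ω.1 (past ω.2 k), x k ω.1 (past ω.2 k), ω.2 k) :=
      mul_pos hμ ((hsupp ω hω).2 k)
    exact div_pos (law_pos hJ0 (fun ω => (O ω.2.2, U ω.2.1, ω.1)) hJpos)
      (law_pos hJ0 (fun ω => (U ω.2.1, ω.1)) hJpos)
  have hWO : ∀ ω, 0 < P ω → ∀ k, 0 < law (W (x k ω.1 (past ω.2 k))) O (O (ω.2 k)) :=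
    fun ω hω k => law_pos (hW0 _) O ((hsupp ω hω).2 k)
  have hTpos : ∀ ω, 0 < P ω → 0 < T ω := fun ω hω =>
    mul_pos (Finset.prod_pos fun i _ => mul_pos (law_pos hQ0 B ((hsupp ω hω).1 i))
        (div_pos ((hsupp ω hω).1 i) (law_pos hQ0 (fun s => (A s, B s)) ((hsupp ω hω).1 i))))
      (mul_pos (Finset.prod_pos fun k _ => mul_pos (hqpos ω hω k)
        (div_pos ((hsupp ω hω).2 k) (hWO ω hω k))) (fanoWeight_pos _ _))
  have hlog : ∀ ω, P ω * Real.log (T ω / P ω) = P ω * (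
      -∑ i, Real.log (LAB (A (ω.1 i), B (ω.1 i)) / LB (B (ω.1 i))) -
      ∑ k, (Real.log (law (W (x k ω.1 (past ω.2 k))) O (O (ω.2 k))) -
        Real.log (q (U (x k ω.1 (past ω.2 k)), l k ω.1 (past ω.2 k)) (O (ω.2 k)))) +
      Real.log (fanoWeight (dec (fun k => O (ω.2 k)) (fun i => B (ω.1 i)))
        (fun i => A (ω.1 i)))) := by
    intro ω
    rcases (hP0 ω).eq_or_lt with h0 | h0
    · simp [← h0]
    congr 1
    obtain ⟨hQp, hWp⟩ := hsupp ω h0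
    have hABp : ∀ i, 0 < LAB (A (ω.1 i), B (ω.1 i)) := fun i =>
      law_pos hQ0 (fun s => (A s, B s)) (hQp i)
    have hBp : ∀ i, 0 < LB (B (ω.1 i)) := fun i => law_pos hQ0 B (hQp i)
    have hr' : ∀ k, 0 < r (x k ω.1 (past ω.2 k)) (ω.2 k) := fun k =>
      div_pos (hWp k) (hWO ω h0 k)
    rw [Real.log_div (hTpos ω h0).ne' h0.ne']
    simp only [hT, hP, processLaw]
    rw [Real.log_mul (Finset.prod_pos fun i _ => mul_pos (hBp i)
        (div_pos (hQp i) (hABp i))).ne' (mul_pos (Finset.prod_pos fun k _ =>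
          mul_pos (hqpos ω h0 k) (hr' k)) (fanoWeight_pos _ _)).ne',
      Real.log_mul (Finset.prod_pos fun k _ =>
          mul_pos (hqpos ω h0 k) (hr' k)).ne' (fanoWeight_pos _ _).ne',
      Real.log_mul (Finset.prod_pos fun i _ => hQp i).ne' (Finset.prod_pos fun k _ => hWp k).ne',
      Real.log_prod fun i _ => (mul_pos (hBp i) (div_pos (hQp i) (hABp i))).ne',
      Real.log_prod fun k _ => (mul_pos (hqpos ω h0 k) (hr' k)).ne',
      Real.log_prod fun i _ => (hQp i).ne', Real.log_prod fun k _ => (hWp k).ne']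
    have e1 : ∀ i, Real.log (LB (B (ω.1 i)) * (Q (ω.1 i) / LAB (A (ω.1 i), B (ω.1 i)))) =
        Real.log (Q (ω.1 i)) - Real.log (LAB (A (ω.1 i), B (ω.1 i)) / LB (B (ω.1 i))) := by
      intro i
      rw [Real.log_mul (hBp i).ne' (div_pos (hQp i) (hABp i)).ne',
        Real.log_div (hQp i).ne' (hABp i).ne', Real.log_div (hABp i).ne' (hBp i).ne']
      ring
    have e2 : ∀ k, Real.log (q (U (x k ω.1 (past ω.2 k)), l k ω.1 (past ω.2 k)) (O (ω.2 k)) *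
          r (x k ω.1 (past ω.2 k)) (ω.2 k)) = Real.log (W (x k ω.1 (past ω.2 k)) (ω.2 k)) -
        (Real.log (law (W (x k ω.1 (past ω.2 k))) O (O (ω.2 k))) -
        Real.log (q (U (x k ω.1 (past ω.2 k)), l k ω.1 (past ω.2 k)) (O (ω.2 k)))) := by
      intro k
      rw [Real.log_mul (hqpos ω h0 k).ne' (hr' k).ne']
      simp only [hr]
      rw [Real.log_div (hWp k).ne' (hWO ω h0 k).ne']
      ring
    simp only [e1, e2, Finset.sum_sub_distrib]
    ring
  have hgibbs := sum_mul_log_div_nonpos hP0 hT0 hTpos hT1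
  simp only [hlog, mul_add, mul_sub, mul_neg, Finset.sum_add_distrib, Finset.sum_sub_distrib,
    Finset.sum_neg_distrib] at hgibbs
  have hent : ∑ ω, P ω * ∑ i, Real.log (LAB (A (ω.1 i), B (ω.1 i)) / LB (B (ω.1 i))) =
      -(m * condEntropy Q A B) := by
    simp only [Finset.mul_sum]
    rw [Finset.sum_comm, condEntropy_eq, mul_neg, neg_neg]
    simp only [hP, sum_processLaw_source_apply hQ1 hW1 _
      fun s => Real.log (LAB (A s, B s) / LB (B s))]
    simp [hLAB, hLB]
  -- The accumulated log-likelihood ratio of channel law against `q` has expectation exactly `n`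
  -- times the single-letter information.
  have hinfo := sum_labelIOLaw_mul (Q := Q) (W := W) (x := x) (l := l) hn hW1 fun i x z =>
    Real.log (law (W x) O (O z)) - Real.log (q (U x, i) (O z))
  rw [← condMutualInfo_labelIOLaw hμ0 hW0 hW1 R O U hinj] at hinfo
  have hfano : -Real.log 2 - (∑ ω, P ω *
        if dec (fun k => O (ω.2 k)) (fun i => B (ω.1 i)) ≠ (fun i => A (ω.1 i)) then 1 else 0) *
        (m * Real.log (Fintype.card α)) ≤
      ∑ ω, P ω * Real.log (fanoWeight (dec (fun k => O (ω.2 k)) (fun i => B (ω.1 i)))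
        (fun i => A (ω.1 i))) := by
    have h1 : -Real.log 2 = ∑ ω, P ω * -Real.log 2 := by
      rw [← Finset.sum_mul, hP, sum_processLaw hQ1 hW1, one_mul]
    rw [h1, Finset.sum_mul, ← Finset.sum_sub_distrib]
    refine Finset.sum_le_sum fun ω _ => ?_
    rw [mul_assoc, ← mul_sub]
    refine mul_le_mul_of_nonneg_left (le_trans (le_of_eq ?_) (log_fanoWeight_ge _ _)) (hP0 ω)
    simp [Fintype.card_pi]
  simp only [mul_sub, Finset.sum_sub_distrib] at hinfo
  rw [hent] at hgibbs
  linarith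

end Converse

/-! ### Compactness, Carathéodory and disintegration. -/

section Convex

theorem exists_of_forall_le_add {J : Type*} {K : Set (J → ℝ)} [Fintype J] (hK : IsCompact K)
    (H : J → ℝ) (κ : ℝ) (h : ∀ η > 0, ∃ f ∈ K, ∀ j, H j ≤ κ * f j + η) :
    ∃ f ∈ K, ∀ j, H j ≤ κ * f j := by
  choose f hfK hf using fun N : ℕ => h (1 / ((N : ℝ) + 1)) Nat.one_div_pos_of_nat
  obtain ⟨g, hg, φ, hφ, hlim⟩ := hK.tendsto_subseq hfK
  refine ⟨g, hg, fun j => ?_⟩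
  have h1 : Tendsto (fun N => κ * f (φ N) j + 1 / ((φ N : ℝ) + 1)) atTop (nhds (κ * g j + 0)) :=
    (((tendsto_pi_nhds.1 hlim) j).const_mul κ).add
      (tendsto_one_div_add_atTop_nhds_zero_nat.comp hφ.tendsto_atTop)
  rw [add_zero] at h1
  exact ge_of_tendsto' h1 fun N => hf (φ N) j

/-- Carathéodory's theorem with a fixed index set. -/
theorem exists_stdSimplex_sum_of_mem_convexHull {d : ℕ} {K : Set (Fin d → ℝ)} {f : Fin d → ℝ}
    (hf : f ∈ convexHull ℝ K) :
    ∃ w ∈ stdSimplex ℝ (Fin (d + 1)), ∃ z : Fin (d + 1) → Fin d → ℝ, (∀ i, z i ∈ K) ∧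
      ∑ i, w i • z i = f := by
  obtain ⟨ι, _, z, w, hz, hind, hw0, hw1, hsum⟩ := eq_pos_convex_span_of_mem_convexHull hf
  have hcard : Fintype.card ι ≤ Fintype.card (Fin (d + 1)) := by
    refine hind.card_le_finrank_succ.trans ?_
    have := Submodule.finrank_le (vectorSpan ℝ (Set.range z))
    simpa using this
  obtain ⟨e⟩ := Function.Embedding.nonempty_of_card_le hcard
  -- The unused indices get weight `0`, but their points must still lie in `K`; an arbitrary used
  -- point serves.
  have hne : Nonempty ι := by
    by_contra h
    rw [not_nonempty_iff] at h
    simp at hw1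
  have hw' : ∀ i, Function.extend e w 0 (e i) = w i := fun i => e.injective.extend_apply _ _ _
  have hz' : ∀ i, Function.extend e z (fun _ => z hne.some) (e i) = z i :=
    fun i => e.injective.extend_apply _ _ _
  have hw'' : ∀ j ∉ Set.range e, Function.extend e w 0 j = 0 := fun j hj =>
    Function.extend_apply' _ _ _ hj
  refine ⟨Function.extend e w 0, ⟨fun j => ?_, ?_⟩, Function.extend e z fun _ => z hne.some,
    fun j => ?_, ?_⟩
  · by_cases hj : j ∈ Set.range e
    · obtain ⟨i, rfl⟩ := hj
      rw [hw']
      exact (hw0 i).le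
    · rw [hw'' j hj]
  · rw [← hw1]
    exact (Fintype.sum_of_injective e e.injective _ _ hw'' fun i => (hw' i).symm).symm
  · by_cases hj : j ∈ Set.range e
    · obtain ⟨i, rfl⟩ := hj
      rw [hz']
      exact hz ⟨i, rfl⟩
    · rw [Function.extend_apply' _ _ _ hj]
      exact hz ⟨_, rfl⟩
  · rw [← hsum]
    refine (Fintype.sum_of_injective e e.injective _ _ (fun j hj => ?_) fun i => ?_).symm
    · rw [hw'' j hj, zero_smul]
    · rw [hw', hz']

/-- By Carathéodory the hull is a continuous image of simplex times `K ^ (d + 1)`, a compact set. -/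
theorem isCompact_convexHull_of_isCompact {d : ℕ} {K : Set (Fin d → ℝ)} (hK : IsCompact K) :
    IsCompact (convexHull ℝ K) := by
  have h : convexHull ℝ K =
      (fun t : (Fin (d + 1) → ℝ) × (Fin (d + 1) → Fin d → ℝ) => ∑ i, t.1 i • t.2 i) ''
        (stdSimplex ℝ (Fin (d + 1)) ×ˢ Set.pi Set.univ fun _ => K) := by
    refine Set.Subset.antisymm (fun f hf => ?_) ?_
    · obtain ⟨w, hw, z, hz, h⟩ := exists_stdSimplex_sum_of_mem_convexHull hf
      exact ⟨(w, z), ⟨hw, fun i _ => hz i⟩, h⟩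
    · rintro _ ⟨⟨w, z⟩, ⟨hw, hz⟩, rfl⟩
      exact (convex_convexHull ℝ K).sum_mem (fun i _ => hw.1 i) hw.2
        fun i _ => subset_convexHull ℝ K (hz i trivial)
  rw [h]
  refine ((isCompact_stdSimplex ℝ _).prod (isCompact_univ_pi fun _ => hK)).image ?_
  fun_prop

/-- Every joint p.m.f. factors into a marginal and conditional p.m.f.s. -/
theorem exists_disintegration {ι X : Type*} [Fintype ι] [Fintype X] {μ : ι × X → ℝ}
    (hμ0 : ∀ d, 0 ≤ μ d) (hμ1 : ∑ d, μ d = 1) :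
    ∃ (w : stdSimplex ℝ ι) (p : ι → stdSimplex ℝ X), (∀ i x, μ (i, x) = w i * p i x) ∧
      ∀ i, (∀ x, p i x ≠ 0 → 0 < μ (i, x)) ∨ ∃ x₀, ∀ x, x ≠ x₀ → p i x = 0 := by
  classical
  have hX : Nonempty X := by
    by_contra h
    rw [not_nonempty_iff] at h
    simp at hμ1
  set w : ι → ℝ := fun i => ∑ x, μ (i, x) with hw
  have hw0 : ∀ i, 0 ≤ w i := fun i => Finset.sum_nonneg fun x _ => hμ0 _
  have key : ∀ i, ∃ p : stdSimplex ℝ X, (∀ x, μ (i, x) = w i * p x) ∧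
      ((∀ x, p x ≠ 0 → 0 < μ (i, x)) ∨ ∃ x₀, ∀ x, x ≠ x₀ → p x = 0) := by
    intro i
    by_cases h : w i = 0
    -- A label of mass zero gets a point mass, so that even there the conditional law will fix the
    -- relay input.
    · refine ⟨⟨Pi.single hX.some 1, single_mem_stdSimplex ℝ _⟩, fun x => ?_,
        Or.inr ⟨hX.some, fun x hx => Pi.single_eq_of_ne hx _⟩⟩
      rw [h, zero_mul]
      exact (Finset.sum_eq_zero_iff_of_nonneg fun x _ => hμ0 (i, x)).1 h x (Finset.mem_univ x)
    · refine ⟨⟨fun x => μ (i, x) / w i, fun x => div_nonneg (hμ0 _) (hw0 _), ?_⟩,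
        fun x => (mul_div_cancel₀ _ h).symm, Or.inl fun x hx => (hμ0 _).lt_of_ne fun h0 =>
          hx (show μ (i, x) / w i = 0 by rw [← h0, zero_div])⟩
      rw [← Finset.sum_div]
      exact div_self h
  choose p hp hp' using key
  exact ⟨⟨w, hw0, by rw [← hμ1, Fintype.sum_prod_type]⟩, p, hp, hp'⟩

end Convex

/-! ### Informations of the relay channel as functions of the input law. -/

section Channel

variable {X₁ X₂ X₃ Y Y₃ : Type*} [Fintype Y] [Fintype Y₃]

/-- The channel law with bundled inputs. -/
def Channel.kernel (ch : Channel X₁ X₂ X₃ Y Y₃) (x : X₁ × X₂ × X₃) (z : Y × Y₃) : ℝ :=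
  ch x.1 x.2.1 x.2.2 z

theorem Channel.kernel_nonneg (ch : Channel X₁ X₂ X₃ Y Y₃) (x : X₁ × X₂ × X₃) (z : Y × Y₃) :
    0 ≤ ch.kernel x z :=
  stdSimplex.zero_le _ _

theorem Channel.sum_kernel (ch : Channel X₁ X₂ X₃ Y Y₃) (x : X₁ × X₂ × X₃) :
    ∑ z, ch.kernel x z = 1 :=
  stdSimplex.sum_eq_one _

variable [Fintype X₁] [Fintype X₂] [Fintype X₃]

theorem inputOutputLaw_nonneg (ch : Channel X₁ X₂ X₃ Y Y₃) (p : stdSimplex ℝ (X₁ × X₂ × X₃))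
    (ω : X₁ × X₂ × X₃ × Y × Y₃) : 0 ≤ inputOutputLaw ch p ω :=
  mul_nonneg (stdSimplex.zero_le _ _) (stdSimplex.zero_le _ _)

/-- Grouping the inputs and the outputs. -/
def inputOutputEquiv : X₁ × X₂ × X₃ × Y × Y₃ ≃ (X₁ × X₂ × X₃) × Y × Y₃ where
  toFun ω := ((ω.1, ω.2.1, ω.2.2.1), ω.2.2.2)
  invFun ω := (ω.1.1, ω.1.2.1, ω.1.2.2, ω.2)
  left_inv _ := rfl
  right_inv _ := rfl

variable {ρ 𝒪 υ : Type*} [Fintype ρ] [Fintype 𝒪] [Fintype υ]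

/-- `I(R ; O | U)` for functions `R`, `U` of the inputs and a function `O` of the outputs. -/
noncomputable def channelInfo (ch : Channel X₁ X₂ X₃ Y Y₃) (R : X₁ × X₂ × X₃ → ρ)
    (O : Y × Y₃ → 𝒪) (U : X₁ × X₂ × X₃ → υ) (p : stdSimplex ℝ (X₁ × X₂ × X₃)) : ℝ :=
  condMutualInfo (inputOutputLaw ch p) (fun ω => R (ω.1, ω.2.1, ω.2.2.1)) (fun ω => O ω.2.2.2)
    (fun ω => U (ω.1, ω.2.1, ω.2.2.1))

theorem channelInfo_nonneg (ch : Channel X₁ X₂ X₃ Y Y₃) (R : X₁ × X₂ × X₃ → ρ)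
    (O : Y × Y₃ → 𝒪) (U : X₁ × X₂ × X₃ → υ) (p : stdSimplex ℝ (X₁ × X₂ × X₃)) :
    0 ≤ channelInfo ch R O U p :=
  condMutualInfo_nonneg (inputOutputLaw_nonneg ch p) _ _ _

theorem continuous_channelInfo (ch : Channel X₁ X₂ X₃ Y Y₃) (R : X₁ × X₂ × X₃ → ρ)
    (O : Y × Y₃ → 𝒪) (U : X₁ × X₂ × X₃ → υ) : Continuous (channelInfo ch R O U) :=
  continuous_condMutualInfo
    (fun _ => ((continuous_apply _).comp continuous_subtype_val).mul continuous_const)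
    (fun p => inputOutputLaw_nonneg ch p) _ _ _

theorem condMutualInfo_labelIOLaw_eq_sum {ι : Type*} [Fintype ι] (ch : Channel X₁ X₂ X₃ Y Y₃)
    (R : X₁ × X₂ × X₃ → ρ) (O : Y × Y₃ → 𝒪) (U : X₁ × X₂ × X₃ → υ)
    {μ : ι × X₁ × X₂ × X₃ → ℝ} {w : ι → ℝ} {p : ι → stdSimplex ℝ (X₁ × X₂ × X₃)}
    (h : ∀ i x, μ (i, x) = w i * p i x) :
    condMutualInfo (labelIOLaw ch.kernel μ) (fun ω => R ω.2.1) (fun ω => O ω.2.2)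
      (fun ω => (U ω.2.1, ω.1)) = ∑ i, w i * channelInfo ch R O U (p i) := by
  have h1 : labelIOLaw ch.kernel μ = fun ω : ι × (X₁ × X₂ × X₃) × Y × Y₃ =>
      w ω.1 * (fun (i : ι) (d : (X₁ × X₂ × X₃) × Y × Y₃) =>
        p i d.1 * ch.kernel d.1 d.2) ω.1 ω.2 := by
    funext ω
    simp only [labelIOLaw, h, mul_assoc]
  rw [h1, condMutualInfo_mixture
    (P := fun (i : ι) (d : (X₁ × X₂ × X₃) × Y × Y₃) => p i d.1 * ch.kernel d.1 d.2)
    (fun d => R d.1) (fun d => O d.2) (fun d => U d.1)]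
  refine Finset.sum_congr rfl fun i _ => ?_
  rw [← condMutualInfo_comp_equiv inputOutputEquiv]
  rfl

end Channel

/-- Normalization per source sample; `n ≤ κ m` may be multiplied by `I` because `I` is nonnegative.
-/
theorem le_of_converse_bound {m n : ℕ} {H I κ η L : ℝ} (hm : 0 < m) (hnm : (n : ℝ) ≤ κ * m) (hI : 0 ≤ I)
    (h : m * H ≤ n * I + L) (hL : L ≤ m * η) : H ≤ κ * I + η := by
  have hm' : (0 : ℝ) < m := Nat.cast_pos.2 hm
  refine le_of_mul_le_mul_left ?_ hm'
  calc m * H ≤ κ * m * I + m * η :=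
        h.trans (add_le_add (mul_le_mul_of_nonneg_right hnm hI) hL)
    _ = m * (κ * I + η) := by ring

/-! ### The converse applied to codes. -/

section Code

variable {S₁ S₂ W W₃ X₁ X₂ X₃ Y Y₃ : Type*}
  [Fintype S₁] [Fintype S₂] [Fintype W] [Fintype W₃] [Fintype Y] [Fintype Y₃] {m n : ℕ}

/-- The channel inputs of a code as functions of sources and past outputs. -/
def Code.input (C : Code S₁ S₂ W W₃ X₁ X₂ X₃ Y Y₃ m n) (k : Fin n)
    (s : Fin m → S₁ × S₂ × W × W₃) (h : Fin (k : ℕ) → Y × Y₃) : X₁ × X₂ × X₃ :=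
  (C.enc₁ (fun i => (s i).1) k, C.enc₂ (fun i => (s i).2.1) k,
    C.relay k (fun j => (h j).2) (fun i => (s i).2.2.2))

theorem Code.errorProb_nonneg (C : Code S₁ S₂ W W₃ X₁ X₂ X₃ Y Y₃ m n)
    (Q : Source S₁ S₂ W W₃) (ch : Channel X₁ X₂ X₃ Y Y₃) : 0 ≤ C.errorProb Q ch :=
  Finset.sum_nonneg fun s _ => Finset.sum_nonneg fun y _ => by
    split_ifs
    · exact processLaw_nonneg (Q := Q) (W := ch.kernel) (x := C.input)
        (stdSimplex.zero_le Q) ch.kernel_nonneg (s, y)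
    · exact le_rfl

theorem Achievable.exists_code {Q : Source S₁ S₂ W W₃} {ch : Channel X₁ X₂ X₃ Y Y₃} {κ : ℝ}
    (h : Achievable Q ch κ) {η : ℝ} (hη : 0 < η) (c : ℝ) (hc : 0 ≤ c) :
    ∃ n m : ℕ, n ≠ 0 ∧ 0 < m ∧ (n : ℝ) ≤ κ * m ∧ ∃ C : Code S₁ S₂ W W₃ X₁ X₂ X₃ Y Y₃ m n,
      ∀ c' ≤ c, Real.log 2 + C.errorProb Q ch * (m * c') ≤ m * η := by
  -- Half of `η` pays for `log 2` through a large `m`, the other half for the error term; `c + 1`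
  -- avoids dividing by zero when `c = 0`. One code then serves all three bounds.
  obtain ⟨M, hM⟩ := exists_nat_gt (2 * Real.log 2 / η)
  obtain ⟨n, m, hn, hm, hnm, C, hC⟩ := h (η / (2 * (c + 1))) (by positivity) 0 M
  refine ⟨n, m, by omega, by omega, hnm, C, fun c' hc' => ?_⟩
  have hm' : (M : ℝ) < m := Nat.cast_lt.2 hm
  have hm0 : (0 : ℝ) ≤ m := Nat.cast_nonneg _
  have h1 : 2 * Real.log 2 ≤ m * η := by
    have := hM.trans hm'
    rw [div_lt_iff₀ hη] at this
    exact this.le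
  have h2 : C.errorProb Q ch * (m * c') ≤ m * (η / 2) :=
    calc C.errorProb Q ch * (m * c') ≤ C.errorProb Q ch * (m * (c + 1)) :=
          mul_le_mul_of_nonneg_left (mul_le_mul_of_nonneg_left (hc'.trans (by linarith)) hm0)
            (C.errorProb_nonneg Q ch)
      _ ≤ η / (2 * (c + 1)) * (m * (c + 1)) :=
          mul_le_mul_of_nonneg_right hC.le (by positivity)
      _ = m * (η / 2) := by field_simp
  linarith

variable [Fintype X₁] [Fintype X₂] [Fintype X₃]

/-- By `hdec` the derived decoder errs only when the code does, so its error may be replaced by that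
of the code. Hence a decoder given extra side information, or asked for one source only, is covered.
-/
theorem Code.converse_bound (C : Code S₁ S₂ W W₃ X₁ X₂ X₃ Y Y₃ m n)
    (Q : Source S₁ S₂ W W₃) (ch : Channel X₁ X₂ X₃ Y Y₃) (hn : n ≠ 0)
    {ι α β ρ 𝒪 υ : Type*} [Fintype ι] [Fintype α] [Fintype β] [Fintype ρ] [Fintype 𝒪] [Fintype υ]
    {l : (k : Fin n) → (Fin m → S₁ × S₂ × W × W₃) → (Fin (k : ℕ) → Y × Y₃) → ι}
    {w : stdSimplex ℝ ι} {p : ι → stdSimplex ℝ (X₁ × X₂ × X₃)}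
    (hp : ∀ i x, labelInputLaw Q ch.kernel C.input l (i, x) = w i * p i x)
    (A : S₁ × S₂ × W × W₃ → α) (B : S₁ × S₂ × W × W₃ → β) (R : X₁ × X₂ × X₃ → ρ)
    (O : Y × Y₃ → 𝒪) (U : X₁ × X₂ × X₃ → υ)
    (hinj : ∀ i x x', 0 < labelInputLaw Q ch.kernel C.input l (i, x) →
      0 < labelInputLaw Q ch.kernel C.input l (i, x') → R x = R x' → U x = U x' → x = x')
    (c : (k : Fin n) → (Fin (k : ℕ) → 𝒪) → (Fin m → β) → υ × ι)
    (hc : ∀ k s h, (U (C.input k s h), l k s h) = c k (fun j => O (h j)) (fun i => B (s i)))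
    (dec : (Fin n → 𝒪) → (Fin m → β) → Fin m → α)
    (hdec : ∀ (s : Fin m → S₁ × S₂ × W × W₃) (y : Fin n → Y × Y₃),
      C.dec (fun k => (y k).1) (fun i => (s i).2.2.1) =
        (fun i => (s i).1, fun i => (s i).2.1) →
      dec (fun k => O (y k)) (fun i => B (s i)) = fun i => A (s i)) :
    m * condEntropy Q A B ≤ n * ∑ i, w i * channelInfo ch R O U (p i) + Real.log 2 +
      C.errorProb Q ch * (m * Real.log (Fintype.card α)) := by
  classical
  have h := MARC.converse_bound hn (stdSimplex.zero_le Q) (stdSimplex.sum_eq_one Q)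
    ch.kernel_nonneg ch.sum_kernel A B R O U hinj c hc dec
  rw [condMutualInfo_labelIOLaw_eq_sum ch R O U hp] at h
  refine h.trans (add_le_add le_rfl (mul_le_mul_of_nonneg_right ?_
    (mul_nonneg (Nat.cast_nonneg _) (Real.log_natCast_nonneg _))))
  rw [Fintype.sum_prod_type, Code.errorProb]
  refine Finset.sum_le_sum fun s _ => Finset.sum_le_sum fun y _ => ?_
  have h0 : 0 ≤ processLaw Q ch.kernel C.input (s, y) :=
    processLaw_nonneg (stdSimplex.zero_le Q) ch.kernel_nonneg _
  by_cases hd : C.dec (fun k => (y k).1) (fun i => (s i).2.2.1) =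
      (fun i => (s i).1, fun i => (s i).2.1)
  · simp [hdec s y hd, hd]
  · rw [if_pos hd]
    refine (mul_le_of_le_one_right h0 ?_).trans le_rfl
    split_ifs <;> norm_num

end Code

/-! ### The two outer bounds. -/

theorem sum_inputOutputLaw {X₁ X₂ X₃ Y Y₃ : Type*}
    [Fintype X₁] [Fintype X₂] [Fintype X₃] [Fintype Y] [Fintype Y₃]
    (ch : MARC.Channel X₁ X₂ X₃ Y Y₃) (p : stdSimplex ℝ (X₁ × X₂ × X₃)) :
    ∑ ω, inputOutputLaw ch p ω = 1 := by
  rw [← inputOutputEquiv.symm.sum_comp, Fintype.sum_prod_type, ← stdSimplex.sum_eq_one p]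
  refine Finset.sum_congr rfl fun x _ => ?_
  change ∑ z, p x * ch.kernel x z = p x
  rw [← Finset.mul_sum, ch.sum_kernel, mul_one]

open scoped Classical in
/-- If the relay input is a function of the auxiliary variable, the joint law is a mixture of
input-output laws. -/
theorem auxInputOutputLaw_eq_mixture {V X₁ X₂ X₃ Y Y₃ : Type*} [Fintype V]
    [Fintype X₁] [Fintype X₂] [Fintype X₃] [Fintype Y] [Fintype Y₃]
    (ch : MARC.Channel X₁ X₂ X₃ Y Y₃) (w : stdSimplex ℝ V)
    (p : V → stdSimplex ℝ (X₁ × X₂ × X₃)) (x₃ : V → X₃)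
    (hx₃ : ∀ v x, x.2.2 ≠ x₃ v → p v x = 0) :
    auxInputOutputLaw ch w (fun v => stdSimplex.map (fun x => (x.1, x.2.1)) (p v))
        (fun v => ⟨Pi.single (x₃ v) 1, single_mem_stdSimplex ℝ _⟩) =
      fun ω => w ω.1 * inputOutputLaw ch (p ω.1) ω.2 := by
  funext ⟨v, x₁, x₂, x, y⟩
  have h1 : stdSimplex.map (fun x : X₁ × X₂ × X₃ => (x.1, x.2.1)) (p v) (x₁, x₂) =
      p v (x₁, x₂, x₃ v) := by
    rw [stdSimplex.map_coe, FunOnFinite.linearMap_apply_apply]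
    rw [Finset.sum_eq_single (x₁, x₂, x₃ v)]
    · rintro ⟨a, b, c⟩ h h'
      refine hx₃ v _ fun hc => h' ?_
      simp at h hc
      simp [h, hc]
    · simp
  have h2 : p v (x₁, x₂, x₃ v) * (Pi.single (x₃ v) 1 : X₃ → ℝ) x = p v (x₁, x₂, x) := by
    by_cases h : x = x₃ v
    · subst h; simp
    · rw [Pi.single_eq_of_ne h, mul_zero, hx₃ v _ h]
  change w v * stdSimplex.map _ (p v) (x₁, x₂) * (Pi.single (x₃ v) 1 : X₃ → ℝ) x * _ =
    w v * (p v (x₁, x₂, x) * _)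
  rw [h1, mul_assoc (w v), h2, mul_assoc]

theorem achievable_cutset_bound {S₁ S₂ W W₃ X₁ X₂ X₃ Y Y₃ : Type*}
    [Fintype S₁] [Fintype S₂] [Fintype W] [Fintype W₃]
    [Fintype X₁] [Fintype X₂] [Fintype X₃] [Fintype Y] [Fintype Y₃]
    (Q : MARC.Source S₁ S₂ W W₃) (ch : MARC.Channel X₁ X₂ X₃ Y Y₃)
    (κ : ℝ) (hκ : MARC.Achievable Q ch κ) :
    ∃ p : stdSimplex ℝ (X₁ × X₂ × X₃),
      condEntropy Q (fun s => s.1) (fun s => (s.2.1, s.2.2.1)) ≤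
        κ * channelInfo ch (fun x => (x.1, x.2.2)) (fun z => z.1) (fun x => x.2.1) p ∧
      condEntropy Q (fun s => s.2.1) (fun s => (s.1, s.2.2.1)) ≤
        κ * channelInfo ch (fun x => (x.2.1, x.2.2)) (fun z => z.1) (fun x => x.1) p ∧
      condEntropy Q (fun s => (s.1, s.2.1)) (fun s => s.2.2.1) ≤
        κ * channelInfo ch id (fun z => z.1) (fun _ => ()) p := by
  set F : stdSimplex ℝ (X₁ × X₂ × X₃) → Fin 3 → ℝ := fun p =>
    ![channelInfo ch (fun x => (x.1, x.2.2)) (fun z => z.1) (fun x => x.2.1) p,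
      channelInfo ch (fun x => (x.2.1, x.2.2)) (fun z => z.1) (fun x => x.1) p,
      channelInfo ch id (fun z => z.1) (fun _ => ()) p] with hF
  have hFc : Continuous F := continuous_pi fun j => by
    fin_cases j
    · exact continuous_channelInfo ch (fun x => (x.1, x.2.2)) (fun z => z.1) (fun x => x.2.1)
    · exact continuous_channelInfo ch (fun x => (x.2.1, x.2.2)) (fun z => z.1) (fun x => x.1)
    · exact continuous_channelInfo ch id (fun z => z.1) (fun _ => ())
  suffices key : ∀ η > 0, ∃ f ∈ Set.range F, ∀ j,
      ![condEntropy Q (fun s => s.1) (fun s => (s.2.1, s.2.2.1)),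
        condEntropy Q (fun s => s.2.1) (fun s => (s.1, s.2.2.1)),
        condEntropy Q (fun s => (s.1, s.2.1)) (fun s => s.2.2.1)] j ≤ κ * f j + η by
    obtain ⟨_, ⟨p, rfl⟩, h⟩ := exists_of_forall_le_add (isCompact_range hFc) _ κ key
    exact ⟨p, h 0, h 1, h 2⟩
  intro η hη
  have hc1 := Real.log_natCast_nonneg (Fintype.card S₁)
  have hc2 := Real.log_natCast_nonneg (Fintype.card S₂)
  have hc3 := Real.log_natCast_nonneg (Fintype.card (S₁ × S₂))
  obtain ⟨n, m, hn, hm, hnm, C, hC⟩ := hκ.exists_code hη (Real.log (Fintype.card S₁) +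
    Real.log (Fintype.card S₂) + Real.log (Fintype.card (S₁ × S₂))) (by positivity)
  -- Trivial label: `p ()` is the time average of the input laws, shared by all three bounds.
  obtain ⟨w, p, hp, -⟩ := exists_disintegration
    (μ := labelInputLaw Q ch.kernel C.input (fun _ _ _ => ()))
    (labelInputLaw_nonneg (stdSimplex.zero_le Q) ch.kernel_nonneg)
    (sum_labelInputLaw hn (stdSimplex.sum_eq_one Q) ch.sum_kernel)
  have hw : w () = 1 := by simp
  have h1 := C.converse_bound Q ch hn hp (fun s => s.1) (fun s => (s.2.1, s.2.2.1))
    (fun x => (x.1, x.2.2)) (fun z => z.1) (fun x => x.2.1)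
    (fun _ x x' _ _ hR hU => by
      simp only [Prod.mk.injEq] at hR
      exact Prod.ext hR.1 (Prod.ext hU hR.2))
    (fun k _ b => (C.enc₂ (fun i => (b i).1) k, ())) (fun _ _ _ => rfl)
    (fun o b => (C.dec o fun i => (b i).2).1) fun s y h => by simp only [h]
  have h2 := C.converse_bound Q ch hn hp (fun s => s.2.1) (fun s => (s.1, s.2.2.1))
    (fun x => (x.2.1, x.2.2)) (fun z => z.1) (fun x => x.1)
    (fun _ x x' _ _ hR hU => by
      simp only [Prod.mk.injEq] at hR
      exact Prod.ext hU (Prod.ext hR.1 hR.2))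
    (fun k _ b => (C.enc₁ (fun i => (b i).1) k, ())) (fun _ _ _ => rfl)
    (fun o b => (C.dec o fun i => (b i).2).2) fun s y h => by simp only [h]
  have h3 := C.converse_bound Q ch hn hp (fun s => (s.1, s.2.1)) (fun s => s.2.2.1)
    id (fun z => z.1) (fun _ => ()) (fun _ x x' _ _ hR _ => hR)
    (fun _ _ _ => ((), ())) (fun _ _ _ => rfl)
    (fun o b i => ((C.dec o b).1 i, (C.dec o b).2 i)) fun s y h => by simp only [h]
  rw [Fintype.sum_unique, show (default : Unit) = () from rfl, hw, one_mul, add_assoc] at h1 h2 h3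
  have g1 := le_of_converse_bound hm hnm (channelInfo_nonneg _ _ _ _ _) h1 (hC _ (by linarith))
  have g2 := le_of_converse_bound hm hnm (channelInfo_nonneg _ _ _ _ _) h2 (hC _ (by linarith))
  have g3 := le_of_converse_bound hm hnm (channelInfo_nonneg _ _ _ _ _) h3 (hC _ (by linarith))
  refine ⟨F (p ()), ⟨p (), rfl⟩, fun j => ?_⟩
  fin_cases j
  exacts [g1, g2, g3]

theorem achievable_genie_bound {S₁ S₂ W W₃ X₁ X₂ X₃ Y Y₃ : Type*}
    [Fintype S₁] [Fintype S₂] [Fintype W] [Fintype W₃]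
    [Fintype X₁] [Fintype X₂] [Fintype X₃] [Fintype Y] [Fintype Y₃]
    (Q : MARC.Source S₁ S₂ W W₃) (ch : MARC.Channel X₁ X₂ X₃ Y Y₃)
    (κ : ℝ) (hκ : MARC.Achievable Q ch κ) :
    ∃ (w : stdSimplex ℝ (Fin 4)) (p : Fin 4 → stdSimplex ℝ (X₁ × X₂ × X₃)) (x₃ : Fin 4 → X₃),
      (∀ v x, x.2.2 ≠ x₃ v → p v x = 0) ∧
      condEntropy Q (fun s => s.1) (fun s => (s.2.1, s.2.2.1, s.2.2.2)) ≤
        κ * ∑ v, w v * channelInfo ch (fun x => x.1) id (fun x => x.2.1) (p v) ∧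
      condEntropy Q (fun s => s.2.1) (fun s => (s.1, s.2.2.1, s.2.2.2)) ≤
        κ * ∑ v, w v * channelInfo ch (fun x => x.2.1) id (fun x => x.1) (p v) ∧
      condEntropy Q (fun s => (s.1, s.2.1)) (fun s => (s.2.2.1, s.2.2.2)) ≤
        κ * ∑ v, w v * channelInfo ch (fun x => (x.1, x.2.1)) id (fun _ => ()) (p v) := by
  set F : stdSimplex ℝ (X₁ × X₂ × X₃) → Fin 3 → ℝ := fun p =>
    ![channelInfo ch (fun x => x.1) id (fun x => x.2.1) p,
      channelInfo ch (fun x => x.2.1) id (fun x => x.1) p,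
      channelInfo ch (fun x => (x.1, x.2.1)) id (fun _ => ()) p] with hF
  have hFc : Continuous F := continuous_pi fun j => by
    fin_cases j
    · exact continuous_channelInfo ch (fun x => x.1) id (fun x => x.2.1)
    · exact continuous_channelInfo ch (fun x => x.2.1) id (fun x => x.1)
    · exact continuous_channelInfo ch (fun x => (x.1, x.2.1)) id (fun _ => ())
  -- Input laws with deterministic relay input. This set does not depend on the block length and is
  -- a finite union of closed sets, hence compact.
  set D : Set (stdSimplex ℝ (X₁ × X₂ × X₃)) :=
    ⋃ x₃ : X₃, {p | ∀ x : X₁ × X₂ × X₃, x.2.2 ≠ x₃ → p x = 0} with hD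
  have hDc : IsCompact D := by
    refine isCompact_iUnion fun x₃ => IsClosed.isCompact ?_
    simp only [Set.ofPred_forall]
    refine isClosed_iInter fun x => isClosed_iInter fun _ => ?_
    exact isClosed_eq ((continuous_apply x).comp continuous_subtype_val) continuous_const
  have key : ∃ f ∈ convexHull ℝ (F '' D), ∀ j,
      ![condEntropy Q (fun s => s.1) (fun s => (s.2.1, s.2.2.1, s.2.2.2)),
        condEntropy Q (fun s => s.2.1) (fun s => (s.1, s.2.2.1, s.2.2.2)),
        condEntropy Q (fun s => (s.1, s.2.1)) (fun s => (s.2.2.1, s.2.2.2))] j ≤ κ * f j := by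
    refine exists_of_forall_le_add (isCompact_convexHull_of_isCompact (hDc.image hFc)) _ κ
      fun η hη => ?_
    have hc1 := Real.log_natCast_nonneg (Fintype.card S₁)
    have hc2 := Real.log_natCast_nonneg (Fintype.card S₂)
    have hc3 := Real.log_natCast_nonneg (Fintype.card (S₁ × S₂))
    obtain ⟨n, m, hn, hm, hnm, C, hC⟩ := hκ.exists_code hη (Real.log (Fintype.card S₁) +
      Real.log (Fintype.card S₂) + Real.log (Fintype.card (S₁ × S₂))) (by positivity)
    classical
    -- The label is the time and everything the relay knows then. The genie-aided receiver, seeing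
    -- `Y₃` and `W₃`, can compute it, as the converse requires.
    set l : (k : Fin n) → (Fin m → S₁ × S₂ × W × W₃) → (Fin (k : ℕ) → Y × Y₃) →
        (k : Fin n) × ((Fin (k : ℕ) → Y₃) × (Fin m → W₃)) :=
      fun k s h => ⟨k, fun j => (h j).2, fun i => (s i).2.2.2⟩ with hl
    have hrelay : ∀ i x, 0 < labelInputLaw Q ch.kernel C.input l (i, x) →
        x.2.2 = C.relay i.1 i.2.1 i.2.2 := by
      intro i x h
      obtain ⟨k, s, h, heq⟩ := exists_of_labelInputLaw_pos h
      obtain ⟨rfl, rfl⟩ := Prod.mk.inj heq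
      rfl
    obtain ⟨w, p, hp, hp'⟩ := exists_disintegration (μ := labelInputLaw Q ch.kernel C.input l)
      (labelInputLaw_nonneg (stdSimplex.zero_le Q) ch.kernel_nonneg)
      (sum_labelInputLaw hn (stdSimplex.sum_eq_one Q) ch.sum_kernel)
    have hpD : ∀ i, p i ∈ D := by
      intro i
      rw [hD, Set.mem_iUnion]
      rcases hp' i with h | ⟨x₀, h⟩
      · refine ⟨C.relay i.1 i.2.1 i.2.2, fun x hx => ?_⟩
        by_contra h0
        exact hx (hrelay i x (h x h0))
      · exact ⟨x₀.2.2, fun x hx => h x fun h0 => hx (by rw [h0])⟩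
    have h1 := C.converse_bound Q ch hn hp (fun s => s.1) (fun s => (s.2.1, s.2.2.1, s.2.2.2))
      (fun x => x.1) id (fun x => x.2.1)
      (fun i x x' hx hx' hR hU =>
        Prod.ext hR (Prod.ext hU ((hrelay i x hx).trans (hrelay i x' hx').symm)))
      (fun k h b => (C.enc₂ (fun i => (b i).1) k, ⟨k, fun j => (h j).2, fun i => (b i).2.2⟩))
      (fun _ _ _ => rfl)
      (fun o b => (C.dec (fun k => (o k).1) fun i => (b i).2.1).1) fun s y h => by
        simp only [id, h]
    have h2 := C.converse_bound Q ch hn hp (fun s => s.2.1) (fun s => (s.1, s.2.2.1, s.2.2.2))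
      (fun x => x.2.1) id (fun x => x.1)
      (fun i x x' hx hx' hR hU =>
        Prod.ext hU (Prod.ext hR ((hrelay i x hx).trans (hrelay i x' hx').symm)))
      (fun k h b => (C.enc₁ (fun i => (b i).1) k, ⟨k, fun j => (h j).2, fun i => (b i).2.2⟩))
      (fun _ _ _ => rfl)
      (fun o b => (C.dec (fun k => (o k).1) fun i => (b i).2.1).2) fun s y h => by
        simp only [id, h]
    have h3 := C.converse_bound Q ch hn hp (fun s => (s.1, s.2.1))
      (fun s => (s.2.2.1, s.2.2.2)) (fun x => (x.1, x.2.1)) id (fun _ => ())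
      (fun i x x' hx hx' hR _ => by
        simp only [Prod.mk.injEq] at hR
        exact Prod.ext hR.1 (Prod.ext hR.2 ((hrelay i x hx).trans (hrelay i x' hx').symm)))
      (fun k h b => ((), ⟨k, fun j => (h j).2, fun i => (b i).2⟩)) (fun _ _ _ => rfl)
      (fun o b i => ((C.dec (fun k => (o k).1) fun i => (b i).1).1 i,
        (C.dec (fun k => (o k).1) fun i => (b i).1).2 i)) fun s y h => by
        simp only [id, h]
    rw [add_assoc] at h1 h2 h3
    have g1 := le_of_converse_bound hm hnm (Finset.sum_nonneg fun i _ => mul_nonneg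
      (stdSimplex.zero_le w i) (channelInfo_nonneg _ _ _ _ _)) h1 (hC _ (by linarith))
    have g2 := le_of_converse_bound hm hnm (Finset.sum_nonneg fun i _ => mul_nonneg
      (stdSimplex.zero_le w i) (channelInfo_nonneg _ _ _ _ _)) h2 (hC _ (by linarith))
    have g3 := le_of_converse_bound hm hnm (Finset.sum_nonneg fun i _ => mul_nonneg
      (stdSimplex.zero_le w i) (channelInfo_nonneg _ _ _ _ _)) h3 (hC _ (by linarith))
    refine ⟨∑ i, w i • F (p i), (convex_convexHull ℝ _).sum_mem
      (fun i _ => stdSimplex.zero_le w i) (stdSimplex.sum_eq_one w) fun i _ =>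
        subset_convexHull ℝ _ ⟨p i, hpD i, rfl⟩, fun j => ?_⟩
    have hF' : (∑ i, w i • F (p i)) j = ∑ i, w i * F (p i) j := by simp [Finset.sum_apply]
    rw [hF']
    fin_cases j
    exacts [g1, g2, g3]
  obtain ⟨f, hf, h⟩ := key
  -- Three informations, so four points of `F '' D` suffice: this is the bound on `|V|`.
  obtain ⟨w, hw, z, hz, rfl⟩ := exists_stdSimplex_sum_of_mem_convexHull hf
  choose p hpD hp using hz
  simp only [hD, Set.mem_iUnion] at hpD
  choose x₃ hx₃ using hpD
  have hF' : ∀ j, (∑ i, w i • z i) j = ∑ i, w i * F (p i) j := fun j => by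
    simp [Finset.sum_apply, hp]
  simp only [hF'] at h
  exact ⟨⟨w, hw⟩, p, x₃, hx₃, h 0, h 1, h 2⟩

end MARC

theorem theorem2 {S₁ S₂ W W₃ X₁ X₂ X₃ Y Y₃ : Type*}
    [Fintype S₁] [Fintype S₂] [Fintype W] [Fintype W₃]
    [Fintype X₁] [Fintype X₂] [Fintype X₃] [Fintype Y] [Fintype Y₃]
    (Q : MARC.Source S₁ S₂ W W₃) (ch : MARC.Channel X₁ X₂ X₃ Y Y₃)
    (κ : ℝ) (hκ : MARC.Achievable Q ch κ) :
    -- constraints for some `p(x₁, x₂, x₃)`; coordinates `ω = (x₁, x₂, x₃, y, y₃)`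
    (∃ p : stdSimplex ℝ (X₁ × X₂ × X₃),
      -- `H(S₁ | S₂, W) ≤ κ I(X₁, X₃ ; Y | X₂)`
      MARC.condEntropy Q (fun s => s.1) (fun s => (s.2.1, s.2.2.1)) ≤
        κ * MARC.condMutualInfo (MARC.inputOutputLaw ch p)
          (fun ω => (ω.1, ω.2.2.1)) (fun ω => ω.2.2.2.1) (fun ω => ω.2.1) ∧
      -- `H(S₂ | S₁, W) ≤ κ I(X₂, X₃ ; Y | X₁)`
      MARC.condEntropy Q (fun s => s.2.1) (fun s => (s.1, s.2.2.1)) ≤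
        κ * MARC.condMutualInfo (MARC.inputOutputLaw ch p)
          (fun ω => (ω.2.1, ω.2.2.1)) (fun ω => ω.2.2.2.1) (fun ω => ω.1) ∧
      -- `H(S₁, S₂ | W) ≤ κ I(X₁, X₂, X₃ ; Y)`
      MARC.condEntropy Q (fun s => (s.1, s.2.1)) (fun s => s.2.2.1) ≤
        κ * MARC.mutualInfo (MARC.inputOutputLaw ch p)
          (fun ω => (ω.1, ω.2.1, ω.2.2.1)) (fun ω => ω.2.2.2.1)) ∧
    -- constraints for some `p(v) p(x₁, x₂ | v) p(x₃ | v)` with `|V| ≤ 4`;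
    -- coordinates `ω = (v, x₁, x₂, x₃, y, y₃)`
    (∃ (V : Type) (_ : Fintype V), Fintype.card V ≤ 4 ∧
      ∃ (pV : stdSimplex ℝ V) (p₁₂ : V → stdSimplex ℝ (X₁ × X₂)) (p₃ : V → stdSimplex ℝ X₃),
      -- `H(S₁ | S₂, W, W₃) ≤ κ I(X₁ ; Y, Y₃ | X₂, V)`
      MARC.condEntropy Q (fun s => s.1) (fun s => (s.2.1, s.2.2.1, s.2.2.2)) ≤
        κ * MARC.condMutualInfo (MARC.auxInputOutputLaw ch pV p₁₂ p₃)
          (fun ω => ω.2.1) (fun ω => (ω.2.2.2.2.1, ω.2.2.2.2.2)) (fun ω => (ω.2.2.1, ω.1)) ∧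
      -- `H(S₂ | S₁, W, W₃) ≤ κ I(X₂ ; Y, Y₃ | X₁, V)`
      MARC.condEntropy Q (fun s => s.2.1) (fun s => (s.1, s.2.2.1, s.2.2.2)) ≤
        κ * MARC.condMutualInfo (MARC.auxInputOutputLaw ch pV p₁₂ p₃)
          (fun ω => ω.2.2.1) (fun ω => (ω.2.2.2.2.1, ω.2.2.2.2.2)) (fun ω => (ω.2.1, ω.1)) ∧
      -- `H(S₁, S₂ | W, W₃) ≤ κ I(X₁, X₂ ; Y, Y₃ | V)`
      MARC.condEntropy Q (fun s => (s.1, s.2.1)) (fun s => (s.2.2.1, s.2.2.2)) ≤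
        κ * MARC.condMutualInfo (MARC.auxInputOutputLaw ch pV p₁₂ p₃)
          (fun ω => (ω.2.1, ω.2.2.1)) (fun ω => (ω.2.2.2.2.1, ω.2.2.2.2.2)) (fun ω => ω.1)) := by
  classical
  constructor
  · obtain ⟨p, h1, h2, h3⟩ := MARC.achievable_cutset_bound Q ch κ hκ
    refine ⟨p, h1, h2, ?_⟩
    rw [MARC.mutualInfo_eq_condMutualInfo (MARC.sum_inputOutputLaw ch p)]
    exact h3
  · obtain ⟨w, p, x₃, hx₃, h1, h2, h3⟩ := MARC.achievable_genie_bound Q ch κ hκ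
    refine ⟨Fin 4, inferInstance, by simp, w,
      fun v => stdSimplex.map (fun x => (x.1, x.2.1)) (p v),
      fun v => ⟨Pi.single (x₃ v) 1, single_mem_stdSimplex ℝ _⟩, ?_⟩
    rw [MARC.auxInputOutputLaw_eq_mixture ch w p x₃ hx₃]
    refine ⟨?_, ?_, ?_⟩
    · refine h1.trans_eq (congrArg _ ?_)
      exact (MARC.condMutualInfo_mixture (P := fun v => MARC.inputOutputLaw ch (p v))
        (fun ω => ω.1) (fun ω => ω.2.2.2) (fun ω => ω.2.1)).symm
    · refine h2.trans_eq (congrArg _ ?_)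
      exact (MARC.condMutualInfo_mixture (P := fun v => MARC.inputOutputLaw ch (p v))
        (fun ω => ω.2.1) (fun ω => ω.2.2.2) (fun ω => ω.1)).symm
    · refine h3.trans_eq (congrArg _ ?_)
      -- A dummy condition brings the third information into the form of the mixture formula.
      rw [MARC.condMutualInfo_congr_right _ _ (Z' := fun ω => ((), ω.1)) (by simp)]
      exact (MARC.condMutualInfo_mixture (P := fun v => MARC.inputOutputLaw ch (p v))
        (fun ω => (ω.1, ω.2.1)) (fun ω => ω.2.2.2) (fun _ => ())).symm
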